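/- Let $\kappa>0$ and let $Z=(Z_t)_{t\ge0}$ be a real-valued càdlàg Markov process (with respect to its natural filtration) that is $\kappa$-self-similar, i.e. $(Z_{ct})_{t\ge0}\stackrel{d}{=}(c^\kappa Z_t)_{t\ge0}$ for all $c>0$ (equality of finite-dimensional distributions; in particular $Z_0=0$ a.s.). Let $P(s,t,x,dy)=\mathbb P(Z_t\in dy\mid Z_s=x)$, $s\le t$, be a version of its transition probabilities which, for each fixed $t$, is measurable in $(s,x)$; at time $0$ only the state $x=0$ is considered. Let $(\zeta_t)_{t\ge0}$ be a subordinator (a càdlàg nondecreasing process with $\zeta_0=0$ and independent stationary increments) independent of $Z$. For $a\in\mathbb R$ put $$X^{(a)}_t=t^{\kappa}e^{-\kappa\zeta_{a+\ln t}}Z_{\exp(\zeta_{a+\ln t})},\qquad t\ge e^{-a}.$$ 1. For every $a$ and every $t\ge e^{-a}$, $X^{(a)}_t\stackrel{d}{=}Z_t$; and for $b\le a$ the processes $(X^{(a)}_t)_{t\ge e^{-b}}$ and $(X^{(b)}_t)_{t\ge e^{-b}}$ have the same finite-dimensional distributions. 2. There is a process $(X_t)_{t\ge0}$ with $X_0=0$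 and paths càdlàg on $(0,\infty)$ such that, for every $a\in\mathbb R$, $(X_t)_{t\ge e^{-a}}\stackrel{d}{=}(X^{(a)}_t)_{t\ge e^{-a}}$ (equality of finite-dimensional distributions). This $X$ is a $\kappa$-self-similar Markov process (with respect to its natural filtration) with transition function $$Q(0,t,0,dy)=P(0,t,0,dy),\qquad Q(s,t,x,dy)=\mathbb E\Big[P\big(e^{-\zeta_{\ln(t/s)}}t,\;t,\;(t/s)^{\kappa}e^{-\kappa\zeta_{\ln(t/s)}}x,\;dy\big)\Big],\quad 0<s\le t,$$ that is, $\mathbb E[g(X_t)\mid\sigma(X_u,u\le s)]=\int g(y)\,Q(s,t,X_s,dy)$ a.s. for all $0\le s\le t$ and all bounded measurable $g$. 3. If moreover $Z$ is a martingale and $\mathbb E\big[e^{-\kappa\zeta_{\ln(t/s)}}\big]=(s/t)^{\kappa}$ for all $0<s\le t$, then $X$ is a martingale (both for the natural filtrations), and almost all paths of $X$ are càdlàg on $[0,\infty)$. 4. If the version $P$ satisfies pointwise $P(s,s,x,\cdot)=\delta_x$, the Chapman–Kolmogorov equations and the scaling property $P(cs,ct,c^\kappa x,c^\kappa dy)=P(s,t,x,dy)$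 for all $c>0$, $s\le t$ and all states $x$ ($x\in\mathbb R$ if $s>0$, $x=0$ if $s=0$), then $Q$ satisfies all three pointwise as well. -/

import Mathlib

open MeasureTheory ProbabilityTheory Filter
open scoped Topology NNReal ENNReal

universe u

namespace Mimicking

/-- A real function on `[0,∞)` is càdlàg at `t`: right-continuous with a finite left limit
(the latter being no condition at `t = 0`). -/
def IsCadlagAt (f : ℝ≥0 → ℝ) (t : ℝ≥0) : Prop :=
  ContinuousWithinAt f (Set.Ici t) t ∧ ∃ l : ℝ, Tendsto f (𝓝[<] t) (𝓝 l)

/-- The processes `X` (under `μ`) and `Y` (under `ν`) have the same finite-dimensional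
distributions at times in `T`. -/
def SameFDD {Ω Ω' : Type*} [MeasurableSpace Ω] [MeasurableSpace Ω'] (T : Set ℝ≥0)
    (X : ℝ≥0 → Ω → ℝ) (μ : Measure Ω) (Y : ℝ≥0 → Ω' → ℝ) (ν : Measure Ω') : Prop :=
  ∀ I : Finset ℝ≥0, (↑I : Set ℝ≥0) ⊆ T →
    IdentDistrib (fun ω (i : I) ↦ X i ω) (fun ω (i : I) ↦ Y i ω) μ ν

/-- `X` is self-similar with exponent `κ`: `(X_{ct})_{t ≥ 0}` and `(c^κ X_t)_{t ≥ 0}` have the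
same finite-dimensional distributions for every `c > 0`. -/
def IsSelfSimilar {Ω : Type*} [MeasurableSpace Ω] (κ : ℝ) (X : ℝ≥0 → Ω → ℝ)
    (μ : Measure Ω) : Prop :=
  ∀ c : ℝ≥0, 0 < c →
    SameFDD Set.univ (fun t ↦ X (c * t)) μ (fun t ω ↦ (c : ℝ) ^ κ * X t ω) μ

/-- A subordinator: a càdlàg nondecreasing process starting from `0` with independent and
stationary increments. -/
structure IsSubordinator {Ω : Type*} [MeasurableSpace Ω] (ζ : ℝ≥0 → Ω → ℝ)
    (μ : Measure Ω) : Prop where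
  measurable : ∀ t, Measurable (ζ t)
  zero : ∀ ω, ζ 0 ω = 0
  mono : ∀ ω, Monotone fun t ↦ ζ t ω
  cadlag : ∀ ω t, IsCadlagAt (fun t ↦ ζ t ω) t
  indep : HasIndepIncrements ζ μ
  stationary : ∀ s h, IdentDistrib (fun ω ↦ ζ (s + h) ω - ζ s ω) (ζ h) μ μ

/-- The states that occur at time `s` for a process started at `0`: every real number if `s > 0`,
only the point `0` if `s = 0`. -/
def IsState (s : ℝ≥0) (x : ℝ) : Prop := 0 < s ∨ x = 0

/-- `P s t x` is, for `s ≤ t` and every state `x` at time `s`, a probability measure (the law at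
time `t` given the state `x` at time `s`), depending measurably on `(s, x)`. -/
structure IsMarkovFamily (P : ℝ≥0 → ℝ≥0 → ℝ → Measure ℝ) : Prop where
  prob : ∀ s t x, s ≤ t → IsState s x → IsProbabilityMeasure (P s t x)
  measurable : ∀ t, Measurable
    fun p : {p : ℝ≥0 × ℝ // 0 < p.1 ∧ p.1 ≤ t} ↦ P p.1.1 t p.1.2

/-- `X` is a Markov process and `P` is its family of transition probabilities
`P s t x = Law (X_t | X_s = x)`: for all `s ≤ t` and bounded measurable `g`, the conditional
expectation of `g (X_t)` given the natural filtration at time `s` is `∫ g(y) P(s,t,X_s,dy)`. -/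
structure IsMarkovProcess {Ω : Type*} [MeasurableSpace Ω] (X : ℝ≥0 → Ω → ℝ)
    (hX : ∀ t, StronglyMeasurable (X t)) (P : ℝ≥0 → ℝ≥0 → ℝ → Measure ℝ)
    (μ : Measure Ω) : Prop where
  family : IsMarkovFamily P
  markov : ∀ s t, s ≤ t → ∀ g : ℝ → ℝ, Measurable g → (∃ C, ∀ y, |g y| ≤ C) →
    μ[fun ω ↦ g (X t ω) | Filtration.natural X hX s]
      =ᵐ[μ] fun ω ↦ ∫ y, g y ∂(P s t (X s ω))

/-- `P(s,s,x,·) = δ_x` and the Chapman–Kolmogorov equations, for every state `x` at time `s`. -/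
structure IsTransitionFunction (P : ℝ≥0 → ℝ≥0 → ℝ → Measure ℝ) : Prop where
  family : IsMarkovFamily P
  self : ∀ s x, IsState s x → P s s x = Measure.dirac x
  chapman_kolmogorov : ∀ s t v x, s ≤ t → t ≤ v → IsState s x → ∀ B : Set ℝ, MeasurableSet B →
    ∫⁻ y, P t v y B ∂(P s t x) = P s v x B

/-- The scaling property `P(cs, ct, c^κ x, c^κ dy) = P(s, t, x, dy)`. -/
def HasScaling (κ : ℝ) (P : ℝ≥0 → ℝ≥0 → ℝ → Measure ℝ) : Prop :=
  ∀ (c s t : ℝ≥0) (x : ℝ), 0 < c → s ≤ t → IsState s x →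
    P (c * s) (c * t) ((c : ℝ) ^ κ * x) = (P s t x).map fun y ↦ (c : ℝ) ^ κ * y

/-- `X^{(a)}_t = t^κ exp(-κ ζ_{a + ln t}) Z_{exp(ζ_{a + ln t})}`; meaningful for `t ≥ e^{-a}`. -/
noncomputable def timeChange {Ω : Type*} (κ : ℝ) (ζ Z : ℝ≥0 → Ω → ℝ) (a : ℝ) (t : ℝ≥0)
    (ω : Ω) : ℝ :=
  (t : ℝ) ^ κ * Real.exp (-κ * ζ (a + Real.log t).toNNReal ω)
    * Z (Real.exp (ζ (a + Real.log t).toNNReal ω)).toNNReal ω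

/-- The randomised kernel: `Q(0,t,x,dy) = P(0,t,x,dy)` (only `x = 0` matters) and, for `0 < s ≤ t`
and `R = exp(-ζ_{ln(t/s)})`, `Q(s,t,x,dy) = E[P(R t, t, (t/s)^κ R^κ x, dy)]`, where the expectation
of a random measure is its mixture over `ω`. -/
noncomputable def randomisedKernel {Ω : Type*} [MeasurableSpace Ω] (κ : ℝ) (ζ : ℝ≥0 → Ω → ℝ)
    (μ : Measure Ω) (P : ℝ≥0 → ℝ≥0 → ℝ → Measure ℝ) (s t : ℝ≥0) (x : ℝ) : Measure ℝ :=
  if s = 0 then P 0 t x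
  else μ.bind fun ω ↦
    P ((Real.exp (-ζ (Real.log (t / s)).toNNReal ω)).toNNReal * t) t
      (((t : ℝ) / s) ^ κ * Real.exp (-κ * ζ (Real.log (t / s)).toNNReal ω) * x)

end Mimicking

/-! In logarithmic time self-similarity is stationarity: `exp(-κ u) Z_{exp u}` has a law invariant
under translations of `u`, and `t^{-κ} X^{(a)}_t` is this stationary process read along the
independent clock `ζ_{a + ln t}`. Once the clock is frozen by Fubini, any shift of it, even a random
one living on the factor of the clock, is a constant and does not change the law. Hence the law of
the time change depends only on the law of the clock up to a common shift
(`identDistrib_timeChange_of_shift`). Shifting by the clock value itself gives the marginals of `Z`;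
shifting by `ζ_{a-b}` and restarting the subordinator there gives consistency in `a`.

To reach all of `(0,∞)` at once, the clock is replaced by a two-sided subordinator evaluated at `ln
t`. Seen from `-A` it has the law of `ζ` (`IsSubordinator.identDistrib_twoSided`), so the resulting
process has the law of every `X^{(a)}` on its range. It is explicit, hence càdlàg on `(0,∞)` path by
path.

For the Markov property, freeze the clock with value `p` at time `s` and `q` at time `t`. The past
involves `Z` only up to time `exp p`, and self-similarity rescales the step of `Z` from `exp p` to
`exp q` into a step from `exp(-(q-p)) t` to `t` (`IsMarkovProcess.lintegral_rescaled`). The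
increment `q - p` is independent of the past of the clock and distributed as `ζ_{ln(t/s)}`;
averaging over it gives the randomised kernel (`lintegral_timeChangeProd`). The martingale property
follows the same route, the moment assumption saying that the factor `(t/s)^κ exp(-κ(q-p))` has mean
`1`. Both identities are checked on finite-dimensional cylinders of the past, which depend only on
finite-dimensional distributions.

Convergence of a martingale path at `0` comes from Doob's maximal inequality and `E|X_δ| = δ^κ
E|X_1|`. The pointwise Chapman–Kolmogorov equations for `Q` combine those of `P` with scaling and
with `ζ_p + ζ'_q ~ ζ_{p+q}` for an independent copy `ζ'`. -/

namespace Mimicking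

/-! ### Independent increments and laws on path space -/

/-- Sums of two families of independent variables, living on two factors of a product space, are
independent. -/
theorem iIndepFun_add_prod {Ω Ω' : Type*} [MeasurableSpace Ω] [MeasurableSpace Ω']
    {μ : Measure Ω} {ν : Measure Ω'} [IsProbabilityMeasure μ] [IsProbabilityMeasure ν] {n : ℕ}
    {α : Fin n → Ω → ℝ} {β : Fin n → Ω' → ℝ} (hα : ∀ k, Measurable (α k))
    (hβ : ∀ k, Measurable (β k)) (hαi : iIndepFun α μ) (hβi : iIndepFun β ν) :
    iIndepFun (fun k (p : Ω × Ω') ↦ α k p.1 + β k p.2) (μ.prod ν) := by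
  have key : iIndepFun (fun k (p : Ω × Ω') ↦ (α k p.1, β k p.2)) (μ.prod ν) := by
    rw [iIndepFun_iff_map_fun_eq_pi_map (by fun_prop)]
    have h1 : ∀ k, (μ.prod ν).map (fun p ↦ (α k p.1, β k p.2))
        = (μ.map (α k)).prod (ν.map (β k)) := fun k ↦
      (Measure.map_prod_map μ ν (hα k) (hβ k)).symm
    have : ∀ k, IsProbabilityMeasure (μ.map (α k)) := fun k ↦
      Measure.isProbabilityMeasure_map (hα k).aemeasurable
    have : ∀ k, IsProbabilityMeasure (ν.map (β k)) := fun k ↦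
      Measure.isProbabilityMeasure_map (hβ k).aemeasurable
    simp_rw [h1]
    -- Regrouping coordinates identifies a product of pair laws with a pair of product laws.
    have h2 := (measurePreserving_arrowProdEquivProdArrow ℝ ℝ (Fin n)
      (fun k ↦ μ.map (α k)) (fun k ↦ ν.map (β k))).symm
    rw [← h2.map_eq, ← hαi.map_fun_eq_pi_map (fun k ↦ (hα k).aemeasurable),
      ← hβi.map_fun_eq_pi_map (fun k ↦ (hβ k).aemeasurable),
      Measure.map_prod_map _ _ (by fun_prop) (by fun_prop),
      Measure.map_map (MeasurableEquiv.measurable _) (by fun_prop)]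
    rfl
  exact key.comp (fun _ p ↦ p.1 + p.2) (fun _ ↦ by fun_prop)

/-- Processes with the same finite-dimensional distributions have the same law on path space. -/
theorem identDistrib_of_forall_finset {T Ω Ω' : Type*} [MeasurableSpace Ω] [MeasurableSpace Ω']
    {μ : Measure Ω} {ν : Measure Ω'} [IsFiniteMeasure μ] [IsFiniteMeasure ν]
    {X : T → Ω → ℝ} {Y : T → Ω' → ℝ} (hX : ∀ t, Measurable (X t)) (hY : ∀ t, Measurable (Y t))
    (h : ∀ I : Finset T, μ.map (fun ω (i : I) ↦ X i ω) = ν.map (fun ω (i : I) ↦ Y i ω)) :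
    IdentDistrib (fun ω t ↦ X t ω) (fun ω t ↦ Y t ω) μ ν := by
  have hX' : Measurable (fun ω t ↦ X t ω) := measurable_pi_lambda _ hX
  have hY' : Measurable (fun ω t ↦ Y t ω) := measurable_pi_lambda _ hY
  refine ⟨hX'.aemeasurable, hY'.aemeasurable, ?_⟩
  -- Both path laws are projective limits of the same family, and such a limit of finite measures is
  -- unique.
  have h1 := isProjectiveLimit_map (P := μ) hX'.aemeasurable
  have h2 := isProjectiveLimit_map (P := ν) hY'.aemeasurable
  have h3 : (fun I : Finset T ↦ μ.map (fun ω ↦ I.restrict (X · ω)))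
      = fun I : Finset T ↦ ν.map (fun ω ↦ I.restrict (Y · ω)) := funext fun I ↦ h I
  rw [h3] at h1
  exact h1.unique h2

theorem SameFDD.identDistrib {Ω Ω' : Type*} [MeasurableSpace Ω] [MeasurableSpace Ω']
    {μ : Measure Ω} {ν : Measure Ω'} [IsFiniteMeasure μ] [IsFiniteMeasure ν]
    {X : ℝ≥0 → Ω → ℝ} {Y : ℝ≥0 → Ω' → ℝ} (hX : ∀ t, Measurable (X t))
    (hY : ∀ t, Measurable (Y t)) (h : SameFDD Set.univ X μ Y ν) :
    IdentDistrib (fun ω t ↦ X t ω) (fun ω t ↦ Y t ω) μ ν :=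
  identDistrib_of_forall_finset hX hY fun I ↦ (h I (Set.subset_univ _)).map_eq

theorem SameFDD.of_identDistrib {Ω Ω' : Type*} [MeasurableSpace Ω] [MeasurableSpace Ω']
    {μ : Measure Ω} {ν : Measure Ω'} {T : Set ℝ≥0} {X : ℝ≥0 → Ω → ℝ} {Y : ℝ≥0 → Ω' → ℝ}
    (h : IdentDistrib (fun ω (t : T) ↦ X t ω) (fun ω (t : T) ↦ Y t ω) μ ν) :
    SameFDD T X μ Y ν := fun I hI ↦
  h.comp (u := fun (x : T → ℝ) (i : I) ↦ x ⟨i, hI i.2⟩) (by fun_prop)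

/-- A finite set of times in `[0, s]` is visited by a monotone sequence which starts at `0`, is at
`s` at some index, and is at `q` from the next index on. -/
theorem exists_monotone_seq (I : Finset ℝ≥0) {s q : ℝ≥0} (hI : ∀ i ∈ I, i ≤ s) (hq : s ≤ q) :
    ∃ (t : ℕ → ℝ≥0) (n : ℕ), Monotone t ∧ t 0 = 0 ∧ t n = s ∧ t (n + 1) = q ∧
      ∀ i ∈ I, ∃ k ≤ n, t k = i := by
  classical
  -- The sequence enumerates `J` increasingly and then stays at `q`; adjoining `0` and `s` makes
  -- them the first and last points of `J`.
  set J : Finset ℝ≥0 := insert 0 (insert s I) with hJ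
  have hJs : ∀ i ∈ J, i ≤ s := by
    intro i hi
    simp only [hJ, Finset.mem_insert] at hi
    rcases hi with rfl | rfl | hi
    · exact zero_le
    · exact le_rfl
    · exact hI i hi
  have h0J : (0 : ℝ≥0) ∈ J := by simp [hJ]
  have hsJ : s ∈ J := by simp [hJ]
  have hne : J.Nonempty := ⟨0, h0J⟩
  have hc : 0 < J.card := hne.card_pos
  let e := J.orderEmbOfFin rfl
  let t : ℕ → ℝ≥0 := fun k ↦ if h : k < J.card then e ⟨k, h⟩ else q
  have hsurj : ∀ i ∈ J, ∃ k, ∃ h : k < J.card, e ⟨k, h⟩ = i := by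
    intro i hi
    have : i ∈ Set.range e := by simpa [e] using hi
    obtain ⟨⟨k, h⟩, hk⟩ := this
    exact ⟨k, h, hk⟩
  have hmem : ∀ k, e k ∈ J := fun k ↦ J.orderEmbOfFin_mem rfl k
  refine ⟨t, J.card - 1, ?_, ?_, ?_, ?_, ?_⟩
  · intro a b hab
    by_cases hb : b < J.card
    · have ha : a < J.card := by omega
      simp only [t, ha, hb, dif_pos]
      exact e.monotone hab
    · by_cases ha : a < J.card
      · simp only [t, ha, hb, dif_pos, dif_neg, not_false_iff]
        exact (hJs _ (hmem _)).trans hq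
      · simp [t, ha, hb]
  · simp only [t, hc, dif_pos]
    obtain ⟨k, h, hk⟩ := hsurj 0 h0J
    refine le_antisymm ?_ (zero_le)
    rw [← hk]
    exact e.monotone (Fin.mk_le_mk.2 (Nat.zero_le k))
  · have h1 : J.card - 1 < J.card := by omega
    simp only [t, h1, dif_pos]
    obtain ⟨k, h, hk⟩ := hsurj s hsJ
    refine le_antisymm (hJs _ (hmem _)) ?_
    nth_rw 1 [← hk]
    exact e.monotone (Fin.mk_le_mk.2 (by omega))
  · have h1 : ¬ (J.card - 1 + 1 < J.card) := by omega
    simp [t, h1]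
  · intro i hi
    obtain ⟨k, h, hk⟩ := hsurj i (by simp [hJ, hi])
    exact ⟨k, by omega, by simp [t, h, hk]⟩

/-- The law on path space of a process with independent increments, started at `0`, is determined
by the laws of the increments. -/
theorem identDistrib_path_of_increments {Ω Ω' : Type*} [MeasurableSpace Ω] [MeasurableSpace Ω']
    {μ : Measure Ω} {ν : Measure Ω'} [IsProbabilityMeasure μ] [IsProbabilityMeasure ν]
    {Y : ℝ≥0 → Ω → ℝ} {Y' : ℝ≥0 → Ω' → ℝ} (hY : ∀ t, Measurable (Y t))
    (hY' : ∀ t, Measurable (Y' t)) (hi : HasIndepIncrements Y μ) (hi' : HasIndepIncrements Y' ν)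
    (h0 : ∀ ω, Y 0 ω = 0) (h0' : ∀ ω, Y' 0 ω = 0)
    (hinc : ∀ s h, IdentDistrib (fun ω ↦ Y (s + h) ω - Y s ω) (fun ω ↦ Y' (s + h) ω - Y' s ω) μ ν) :
    IdentDistrib (fun ω t ↦ Y t ω) (fun ω t ↦ Y' t ω) μ ν := by
  refine identDistrib_of_forall_finset hY hY' fun I ↦ ?_
  obtain ⟨t, n, ht, t0, -, -, hidx⟩ :=
    exists_monotone_seq I (s := I.sup id) (q := I.sup id) (fun i hi ↦ Finset.le_sup (f := id) hi)
      le_rfl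
  choose! k hk htk using hidx
  have hpi := IdentDistrib.pi (X := fun i ω ↦ Y (t (i + 1)) ω - Y (t i) ω)
    (Y := fun i ω ↦ Y' (t (i + 1)) ω - Y' (t i) ω) (μ := μ) (ν := ν) (fun i ↦ by
      have := hinc (t i) (t (i + 1) - t i)
      rwa [add_tsub_cancel_of_le (ht (Nat.le_succ i))] at this) (hi.nat ht) (hi'.nat ht)
  -- Partial sums of increments recover the values of the path, since the sequence starts at time
  -- `0` and the path at `0`.
  have := hpi.comp (u := fun x (i : I) ↦ ∑ j ∈ Finset.range (k i), x j) (by fun_prop)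
  convert this.map_eq using 3 with ω ω
  · ext i
    simp only [Function.comp]
    rw [Finset.sum_range_sub (fun j ↦ Y (t j) ω), t0, h0, htk i i.2, sub_zero]
  · ext i
    simp only [Function.comp]
    rw [Finset.sum_range_sub (fun j ↦ Y' (t j) ω), t0, h0', htk i i.2, sub_zero]

/-- An increment of a process with independent increments, started at `0`, is independent of the
whole past. -/
theorem indepFun_past_increment {Ω : Type*} [MeasurableSpace Ω] {μ : Measure Ω}
    [IsProbabilityMeasure μ] {Y : ℝ≥0 → Ω → ℝ} (hY : ∀ t, Measurable (Y t))
    (hi : HasIndepIncrements Y μ) (h0 : ∀ ω, Y 0 ω = 0) {s q : ℝ≥0} (hq : s ≤ q) :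
    IndepFun (fun ω (u : Set.Iic s) ↦ Y u ω) (fun ω ↦ Y q ω - Y s ω) μ := by
  refine IndepFun.process_indepFun (X := fun (u : Set.Iic s) ω ↦ Y u ω) (fun u ↦ hY u)
    ((hY q).sub (hY s)) fun I ↦ ?_
  obtain ⟨t, n, ht, t0, tn, tn1, hidx⟩ :=
    exists_monotone_seq (I.map (Function.Embedding.subtype _)) (s := s) (q := q)
      (fun i hi ↦ by
        obtain ⟨⟨j, hj⟩, -, rfl⟩ := Finset.mem_map.1 hi
        exact hj) hq
  choose! k hk htk using hidx
  have hI : ∀ i : I, ((i : Set.Iic s) : ℝ≥0) ∈ I.map (Function.Embedding.subtype _) := fun i ↦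
    Finset.mem_map.2 ⟨i, i.2, rfl⟩
  -- The increments numbered below `n` determine the values up to `s`; increment number `n` is `Y q
  -- - Y s`.
  have hind := (hi.nat ht).indepFun_finset (Finset.range n) {n} (by simp) (fun i ↦ by fun_prop)
  have hψ : Measurable fun x : ({n} : Finset ℕ) → ℝ ↦ x ⟨n, by simp⟩ := measurable_pi_apply _
  have := hind.comp
    -- The default `0` is never used, because `k i ≤ n`.
    (φ := fun (x : Finset.range n → ℝ) (i : I) ↦ ∑ j ∈ (Finset.range (k i)).attach,
      if h : (j : ℕ) ∈ Finset.range n then x ⟨j, h⟩ else 0)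
    (ψ := fun (x : ({n} : Finset ℕ) → ℝ) ↦ x ⟨n, by simp⟩) (by
      refine measurable_pi_lambda _ fun i ↦ Finset.measurable_sum _ fun j _ ↦ ?_
      split_ifs <;> fun_prop) hψ
  convert this using 1
  · ext ω i
    simp only [Function.comp]
    have h1 := Finset.sum_range_sub (fun j ↦ Y (t j) ω) (k i)
    rw [t0, h0, htk _ (hI i), sub_zero] at h1
    rw [← h1, ← Finset.sum_attach]
    refine Finset.sum_congr rfl fun j _ ↦ ?_
    have hj := Finset.mem_range.1 j.2
    have := hk _ (hI i)
    rw [dif_pos (Finset.mem_range.2 (by omega))]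
  · ext ω
    simp [Function.comp, tn, tn1]


/-! ### Measurable evaluation of right-continuous paths -/

/-- The dyadic-type approximation `(⌊(n+1)t⌋ + 1)/(n+1)` of `t` from the right. -/
noncomputable def approxRight (n : ℕ) (t : ℝ≥0) : ℝ≥0 := (⌊(n + 1 : ℝ≥0) * t⌋₊ + 1) / (n + 1)

theorem le_approxRight (n : ℕ) (t : ℝ≥0) : t ≤ approxRight n t := by
  rw [approxRight, le_div_iff₀ (by positivity), mul_comm]
  exact (Nat.lt_floor_add_one _).le

theorem approxRight_le (n : ℕ) (t : ℝ≥0) : approxRight n t ≤ t + 1 / (n + 1) := by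
  have h : (0 : ℝ≥0) < n + 1 := by positivity
  rw [approxRight, div_le_iff₀ h, add_mul t, div_mul_cancel₀ _ h.ne', mul_comm t]
  gcongr
  exact Nat.floor_le zero_le

theorem tendsto_approxRight (t : ℝ≥0) :
    Tendsto (fun n ↦ approxRight n t) atTop (𝓝[≥] t) := by
  refine tendsto_nhdsWithin_iff.2 ⟨?_, .of_forall fun n ↦ le_approxRight n t⟩
  refine tendsto_of_tendsto_of_tendsto_of_le_of_le tendsto_const_nhds ?_
    (fun n ↦ le_approxRight n t) (fun n ↦ approxRight_le n t)
  have := (tendsto_one_div_add_atTop_nhds_zero_nat (𝕜 := ℝ≥0)).const_add t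
  rwa [add_zero] at this

/-- The value at `t` of a path `z`, recovered from its values to the right of `t`; a measurable
functional of `(z, t)`, which is `z t` if `z` is right-continuous at `t`. -/
noncomputable def rightEval (z : ℝ≥0 → ℝ) (t : ℝ≥0) : ℝ :=
  limsup (fun n ↦ z (approxRight n t)) atTop

theorem rightEval_eq {z : ℝ≥0 → ℝ} {t : ℝ≥0} (h : ContinuousWithinAt z (Set.Ici t) t) :
    rightEval z t = z t :=
  (h.tendsto.comp (tendsto_approxRight t)).limsup_eq

/-- Evaluation at a variable time is not measurable for the product σ-algebra on all paths. The
approximating time depends on `t` only through an integer, so each approximation reads countably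
many coordinates, and a limsup of measurable functions is measurable. -/
theorem measurable_rightEval : Measurable fun p : (ℝ≥0 → ℝ) × ℝ≥0 ↦ rightEval p.1 p.2 := by
  refine Measurable.limsup fun n ↦ ?_
  have h1 : Measurable fun p : (ℝ≥0 → ℝ) × ℕ ↦ p.1 ((p.2 + 1) / (n + 1)) :=
    measurable_from_prod_countable_left fun m ↦
      measurable_pi_apply (((m : ℝ≥0) + 1) / ((n : ℝ≥0) + 1))
  have h2 : Measurable fun p : (ℝ≥0 → ℝ) × ℝ≥0 ↦ (p.1, ⌊(n + 1 : ℝ≥0) * p.2⌋₊) :=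
    measurable_fst.prodMk (Nat.measurable_floor.comp (measurable_snd.const_mul _))
  exact h1.comp h2

theorem _root_.Measurable.rightEval {α : Type*} [MeasurableSpace α] {f : α → ℝ≥0 → ℝ}
    {g : α → ℝ≥0} (hf : Measurable f) (hg : Measurable g) :
    Measurable fun a ↦ rightEval (f a) (g a) :=
  measurable_rightEval.comp (f := fun a ↦ (f a, g a)) (hf.prodMk hg)

/-- A process with right-continuous paths is jointly measurable. -/
theorem measurable_of_rightContinuous {Ω : Type*} [MeasurableSpace Ω] {Z : ℝ≥0 → Ω → ℝ}
    (hZ : ∀ t, Measurable (Z t))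
    (hr : ∀ ω t, ContinuousWithinAt (fun t ↦ Z t ω) (Set.Ici t) t) :
    Measurable fun p : Ω × ℝ≥0 ↦ Z p.2 p.1 := by
  have h : (fun p : Ω × ℝ≥0 ↦ Z p.2 p.1) = fun p ↦ rightEval (fun t ↦ Z t p.1) p.2 :=
    funext fun p ↦ (rightEval_eq (hr p.1 p.2)).symm
  rw [h]
  exact ((measurable_pi_lambda _ hZ).comp measurable_fst).rightEval measurable_snd

/-! ### Decoupling the clock from the process, and shifting the clock -/

/-- Evaluating a right-continuous process at random times which are functions of an independent
variable: the variable and the process may be put on two factors of a product space. -/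
theorem identDistrib_decouple {Ω A B E ι : Type*} [MeasurableSpace Ω] [MeasurableSpace A]
    [MeasurableSpace B] [MeasurableSpace E] {μ : Measure Ω} [IsProbabilityMeasure μ]
    {α : Measure A} [IsProbabilityMeasure α] {β : Measure B} [IsProbabilityMeasure β]
    {V : Ω → E} {Z : ℝ≥0 → Ω → ℝ} (hr : ∀ ω t, ContinuousWithinAt (fun t ↦ Z t ω) (Set.Ici t) t)
    (hind : IndepFun V (fun ω t ↦ Z t ω) μ)
    {V' : A → E} {Z' : ℝ≥0 → B → ℝ} (hV' : Measurable V') (hZ' : ∀ t, Measurable (Z' t))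
    (hr' : ∀ ω t, ContinuousWithinAt (fun t ↦ Z' t ω) (Set.Ici t) t)
    (hVV' : IdentDistrib V V' μ α)
    (hZZ' : IdentDistrib (fun ω t ↦ Z t ω) (fun ω t ↦ Z' t ω) μ β)
    {k : ι → E → ℝ≥0} (hk : ∀ i, Measurable (k i)) :
    IdentDistrib (fun ω ↦ (V ω, fun i ↦ Z (k i (V ω)) ω))
      (fun p : A × B ↦ (V' p.1, fun i ↦ Z' (k i (V' p.1)) p.2)) μ (α.prod β) := by
  have hZm : Measurable (fun ω t ↦ Z' t ω) := measurable_pi_lambda _ hZ'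
  have h1 : IdentDistrib V (fun p : A × B ↦ V' p.1) μ (α.prod β) := by
    refine ⟨hVV'.aemeasurable_fst, (hV'.comp measurable_fst).aemeasurable, ?_⟩
    rw [hVV'.map_eq, show (fun p : A × B ↦ V' p.1) = V' ∘ Prod.fst from rfl,
      ← Measure.map_map hV' measurable_fst, Measure.map_fst_prod, measure_univ, one_smul]
  have h2 : IdentDistrib (fun ω t ↦ Z t ω) (fun p : A × B ↦ fun t ↦ Z' t p.2) μ (α.prod β) := by
    refine ⟨hZZ'.aemeasurable_fst, (hZm.comp measurable_snd).aemeasurable, ?_⟩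
    rw [hZZ'.map_eq, show (fun (p : A × B) t ↦ Z' t p.2) = (fun ω t ↦ Z' t ω) ∘ Prod.snd from rfl,
      ← Measure.map_map hZm measurable_snd, Measure.map_snd_prod, measure_univ, one_smul]
  -- Independence fixes the joint law of the variable and the whole path; `rightEval` turns random
  -- evaluation into a measurable functional of that pair.
  have h3 := (h1.prodMk h2 hind (indepFun_prod hV' hZm)).comp
    (u := fun x : E × (ℝ≥0 → ℝ) ↦ (x.1, fun i ↦ rightEval x.2 (k i x.1)))
    (measurable_fst.prodMk (measurable_pi_lambda _ fun i ↦
      measurable_snd.rightEval ((hk i).comp measurable_fst)))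
  convert h3 using 1
  · ext ω
    · rfl
    · simp only [Function.comp]
      rw [rightEval_eq (hr _ _)]
  · ext ω
    · rfl
    · simp only [Function.comp]
      rw [rightEval_eq (hr' _ _)]

/-- Self-similarity as an identity of laws on path space. -/
theorem IsSelfSimilar.identDistrib {Ω : Type*} [MeasurableSpace Ω] {κ : ℝ} {Z : ℝ≥0 → Ω → ℝ}
    {μ : Measure Ω} [IsFiniteMeasure μ] (hZ : ∀ t, Measurable (Z t)) (h : IsSelfSimilar κ Z μ)
    {c : ℝ≥0} (hc : 0 < c) :
    IdentDistrib (fun ω t ↦ Z (c * t) ω) (fun ω t ↦ (c : ℝ) ^ κ * Z t ω) μ μ :=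
  SameFDD.identDistrib (fun _ ↦ hZ _) (fun t ↦ (hZ t).const_mul _) (h c hc)

theorem exp_toNNReal_add (x y : ℝ) :
    (Real.exp (x + y)).toNNReal = (Real.exp x).toNNReal * (Real.exp y).toNNReal := by
  rw [Real.exp_add, Real.toNNReal_mul (Real.exp_pos _).le]

theorem exp_toNNReal_rpow (κ x : ℝ) : (((Real.exp x).toNNReal : ℝ≥0) : ℝ) ^ κ = Real.exp (κ * x) := by
  rw [Real.coe_toNNReal _ (Real.exp_pos _).le, ← Real.exp_mul, mul_comm]

/-- The time change `c exp(-κ w) Z_{exp w}` of a self-similar process along several clocks `w` is,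
in law, invariant under a common shift of the clocks. -/
theorem IsSelfSimilar.identDistrib_shift {Ω ι : Type*} [MeasurableSpace Ω] {κ : ℝ}
    {Z : ℝ≥0 → Ω → ℝ} {μ : Measure Ω} [IsFiniteMeasure μ] (hZ : ∀ t, Measurable (Z t))
    (h : IsSelfSimilar κ Z μ) (c w : ι → ℝ) (x : ℝ) :
    IdentDistrib (fun ω i ↦ c i * Real.exp (-κ * w i) * Z (Real.exp (w i)).toNNReal ω)
      (fun ω i ↦ c i * Real.exp (-κ * (w i - x)) * Z (Real.exp (w i - x)).toNNReal ω) μ μ := by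
  -- Scaling by `exp x` replaces `Z_{exp w}` by `exp(κ x) Z_{exp(w - x)}`, and the power is absorbed
  -- into the prefactor.
  have h1 := (h.identDistrib hZ (c := (Real.exp x).toNNReal)
    (Real.toNNReal_pos.2 (Real.exp_pos x))).comp
    (u := fun z i ↦ c i * Real.exp (-κ * w i) * z (Real.exp (w i - x)).toNNReal) (by fun_prop)
  convert h1 using 1
  · ext ω i
    simp only [Function.comp]
    rw [← exp_toNNReal_add, add_sub_cancel]
  · ext ω i
    simp only [Function.comp]
    rw [exp_toNNReal_rpow, show -κ * (w i - x) = -κ * w i + κ * x by ring, Real.exp_add]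
    ring

/-- In the time change of a self-similar process by independent clocks, the process may be put on
another factor of a product space, and the clocks may be shifted. -/
theorem identDistrib_timeChange_prod {C ι : Type*} [MeasurableSpace C] {γ : Measure C}
    [IsProbabilityMeasure γ] {κ : ℝ} (c : ι → ℝ) {Z : ℝ≥0 → C → ℝ} (hZ : ∀ t, Measurable (Z t))
    (hr : ∀ ω t, ContinuousWithinAt (fun t ↦ Z t ω) (Set.Ici t) t)
    (hs : IsSelfSimilar κ Z γ) {W : ι → C → ℝ} {H : C → ℝ} (hW : ∀ i, Measurable (W i))
    (hH : Measurable H) (hind : IndepFun (fun a i ↦ W i a) (fun ω t ↦ Z t ω) γ) :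
    IdentDistrib (fun a i ↦ c i * Real.exp (-κ * W i a) * Z (Real.exp (W i a)).toNNReal a)
      (fun (p : C × C) i ↦ c i * Real.exp (-κ * (W i p.1 - H p.1)) *
        Z (Real.exp (W i p.1 - H p.1)).toNNReal p.2) γ (γ.prod γ) := by
  have hWm : Measurable (fun a i ↦ W i a) := measurable_pi_lambda _ hW
  have hZm := measurable_of_rightContinuous hZ hr
  have h1 := (identDistrib_decouple hr hind hWm hZ hr
    (IdentDistrib.refl hWm.aemeasurable)
    (IdentDistrib.refl (measurable_pi_lambda _ hZ).aemeasurable)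
    (k := fun i w ↦ (Real.exp (w i)).toNNReal) (by fun_prop)).comp
    (u := fun x i ↦ c i * Real.exp (-κ * x.1 i) * x.2 i) (by fun_prop)
  refine h1.trans ?_
  have m1 : Measurable (fun (p : C × C) i ↦ c i * Real.exp (-κ * W i p.1) *
      Z (Real.exp (W i p.1)).toNNReal p.2) := by
    refine measurable_pi_lambda _ fun i ↦ Measurable.mul (by fun_prop) ?_
    exact hZm.comp (f := fun p : C × C ↦ (p.2, (Real.exp (W i p.1)).toNNReal)) (by fun_prop)
  have m2 : Measurable (fun (p : C × C) i ↦ c i * Real.exp (-κ * (W i p.1 - H p.1)) *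
      Z (Real.exp (W i p.1 - H p.1)).toNNReal p.2) := by
    refine measurable_pi_lambda _ fun i ↦ Measurable.mul (by fun_prop) ?_
    exact hZm.comp (f := fun p : C × C ↦ (p.2, (Real.exp (W i p.1 - H p.1)).toNNReal))
      (by fun_prop)
  refine ⟨m1.aemeasurable, m2.aemeasurable, ?_⟩
  ext S hS
  rw [Measure.map_apply (by exact m1) hS, Measure.map_apply m2 hS,
    Measure.prod_apply (by exact m1 hS), Measure.prod_apply (m2 hS)]
  -- With the first factor frozen, the random shift `H a` is a constant, and the deterministic shift
  -- applies to `Z` on the second factor.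
  refine lintegral_congr fun a ↦ ?_
  exact (hs.identDistrib_shift hZ c (fun i ↦ W i a) (H a)).measure_mem_eq hS

/-- The law of the time change of a self-similar process by independent clocks only depends on
the law of the clocks up to a common (random) shift. -/
theorem identDistrib_timeChange_of_shift {A B ι : Type*} [MeasurableSpace A] [MeasurableSpace B]
    {α : Measure A} [IsProbabilityMeasure α] {β : Measure B} [IsProbabilityMeasure β]
    {κ : ℝ} (c : ι → ℝ) {Z : ℝ≥0 → A → ℝ} {Z' : ℝ≥0 → B → ℝ}
    (hZ : ∀ t, Measurable (Z t)) (hZ' : ∀ t, Measurable (Z' t))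
    (hr : ∀ ω t, ContinuousWithinAt (fun t ↦ Z t ω) (Set.Ici t) t)
    (hr' : ∀ ω t, ContinuousWithinAt (fun t ↦ Z' t ω) (Set.Ici t) t)
    (hs : IsSelfSimilar κ Z α) (hs' : IsSelfSimilar κ Z' β)
    (hZZ' : IdentDistrib (fun ω t ↦ Z t ω) (fun ω t ↦ Z' t ω) α β)
    {W : ι → A → ℝ} {W' : ι → B → ℝ} {H : A → ℝ} {H' : B → ℝ}
    (hW : ∀ i, Measurable (W i)) (hW' : ∀ i, Measurable (W' i))
    (hH : Measurable H) (hH' : Measurable H')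
    (hind : IndepFun (fun a i ↦ W i a) (fun ω t ↦ Z t ω) α)
    (hind' : IndepFun (fun b i ↦ W' i b) (fun ω t ↦ Z' t ω) β)
    (hinc : IdentDistrib (fun a i ↦ W i a - H a) (fun b i ↦ W' i b - H' b) α β) :
    IdentDistrib (fun a i ↦ c i * Real.exp (-κ * W i a) * Z (Real.exp (W i a)).toNNReal a)
      (fun b i ↦ c i * Real.exp (-κ * W' i b) * Z' (Real.exp (W' i b)).toNNReal b) α β := by
  refine (identDistrib_timeChange_prod c hZ hr hs hW hH hind).trans (IdentDistrib.trans ?_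
    (identDistrib_timeChange_prod c hZ' hr' hs' hW' hH' hind').symm)
  have hWm : Measurable (fun a i ↦ W i a - H a) := by fun_prop
  have hWm' : Measurable (fun a i ↦ W' i a - H' a) := by fun_prop
  have e1 : Measurable fun ω t ↦ Z t ω := measurable_pi_lambda _ hZ
  have e2 : Measurable fun ω t ↦ Z' t ω := measurable_pi_lambda _ hZ'
  have h : IdentDistrib (fun p : A × A ↦ ((fun i ↦ W i p.1 - H p.1), fun t ↦ Z t p.2))
      (fun p : B × B ↦ ((fun i ↦ W' i p.1 - H' p.1), fun t ↦ Z' t p.2))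
      (α.prod α) (β.prod β) := by
    refine ⟨by fun_prop, by fun_prop, ?_⟩
    have f1 := Measure.map_prod_map α α hWm e1
    have f2 := Measure.map_prod_map β β hWm' e2
    rw [hinc.map_eq, hZZ'.map_eq] at f1
    exact f1.symm.trans f2
  have h' := h.comp (u := fun (x : (ι → ℝ) × (ℝ≥0 → ℝ)) i ↦ c i * Real.exp (-κ * x.1 i) *
    rightEval x.2 (Real.exp (x.1 i)).toNNReal) (by
      refine measurable_pi_lambda _ fun i ↦ Measurable.mul (by fun_prop) ?_
      exact measurable_snd.rightEval (by fun_prop))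
  convert h' using 1
  · ext p i
    simp only [Function.comp]
    rw [rightEval_eq (hr _ _)]
  · ext p i
    simp only [Function.comp]
    rw [rightEval_eq (hr' _ _)]


/-! ### Subordinators and their two-sided extension -/

section Subordinator

variable {Ω : Type*} [MeasurableSpace Ω] {μ : Measure Ω} {ζ : ℝ≥0 → Ω → ℝ}

theorem IsSubordinator.nonneg (hζ : IsSubordinator ζ μ) (t : ℝ≥0) (ω : Ω) : 0 ≤ ζ t ω := by
  have := hζ.mono ω (zero_le (a := t))
  simpa [hζ.zero ω] using this

/-- A subordinator restarted at time `h` has the same law on path space. -/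
theorem IsSubordinator.identDistrib_shift [IsProbabilityMeasure μ] (hζ : IsSubordinator ζ μ)
    (h : ℝ≥0) :
    IdentDistrib (fun ω t ↦ ζ (h + t) ω - ζ h ω) (fun ω t ↦ ζ t ω) μ μ := by
  refine identDistrib_path_of_increments (fun t ↦ (hζ.measurable _).sub (hζ.measurable _))
    hζ.measurable ?_ hζ.indep (by simp) hζ.zero fun s t ↦ ?_
  · intro n t ht
    simpa using hζ.indep n (fun i ↦ h + t i) (fun i j hij ↦ add_le_add_right (ht hij) h)
  · simp only [sub_sub_sub_cancel_right, ← add_assoc]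
    exact (hζ.stationary (h + s) t).trans (hζ.stationary s t).symm

/-- The sum of independent copies of `ζ_p` and `ζ_q` is distributed as `ζ_{p+q}`. -/
theorem IsSubordinator.identDistrib_add [IsProbabilityMeasure μ] (hζ : IsSubordinator ζ μ)
    (p q : ℝ≥0) :
    IdentDistrib (fun x : Ω × Ω ↦ ζ p x.1 + ζ q x.2) (ζ (p + q)) (μ.prod μ) μ := by
  have hp := hζ.measurable p
  have hq := hζ.measurable q
  have h1 : IdentDistrib (ζ p) (fun x : Ω × Ω ↦ ζ p x.1) μ (μ.prod μ) := by
    refine ⟨hp.aemeasurable, by fun_prop, ?_⟩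
    rw [show (fun x : Ω × Ω ↦ ζ p x.1) = ζ p ∘ Prod.fst from rfl,
      ← Measure.map_map hp measurable_fst, Measure.map_fst_prod, measure_univ, one_smul]
  have h2 : IdentDistrib (fun ω ↦ ζ (p + q) ω - ζ p ω) (fun x : Ω × Ω ↦ ζ q x.2) μ (μ.prod μ) := by
    refine (hζ.stationary p q).trans ⟨hq.aemeasurable, by fun_prop, ?_⟩
    rw [show (fun x : Ω × Ω ↦ ζ q x.2) = ζ q ∘ Prod.snd from rfl,
      ← Measure.map_map hq measurable_snd, Measure.map_snd_prod, measure_univ, one_smul]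
  have h3 : IndepFun (ζ p) (fun ω ↦ ζ (p + q) ω - ζ p ω) μ :=
    hζ.indep.indepFun_eval_sub zero_le le_self_add (ae_of_all _ hζ.zero)
  have h4 := (h1.prodMk h2 h3 (indepFun_prod hp hq)).comp
    (u := fun x : ℝ × ℝ ↦ x.1 + x.2) (by fun_prop)
  convert h4.symm using 1 <;> ext ω <;> simp

theorem tendsto_sub_div_nat {v : ℝ≥0} (hv : 0 < v) :
    Tendsto (fun n : ℕ ↦ v - v / (n + 1)) atTop (𝓝[<] v) := by
  refine tendsto_nhdsWithin_iff.2 ⟨?_, .of_forall fun n ↦ tsub_lt_self hv (by positivity)⟩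
  have h := (tendsto_one_div_add_atTop_nhds_zero_nat (𝕜 := ℝ≥0)).const_mul v
  have h' := (tendsto_const_nhds (x := v)).sub h
  simpa [div_eq_mul_inv] using h'

theorem IsSubordinator.tendsto_leftLim (hζ : IsSubordinator ζ μ) {v : ℝ≥0} (hv : 0 < v) (ω : Ω) :
    Tendsto (fun n : ℕ ↦ ζ (v - v / (n + 1)) ω) atTop
      (𝓝 (Function.leftLim (fun t ↦ ζ t ω) v)) :=
  ((hζ.mono ω).tendsto_leftLim v).comp (tendsto_sub_div_nat hv)

theorem IsSubordinator.leftLim_zero (hζ : IsSubordinator ζ μ) (ω : Ω) :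
    Function.leftLim (fun t ↦ ζ t ω) 0 = 0 := by
  rw [leftLim_eq_of_isBot (fun _ ↦ zero_le), hζ.zero]

theorem IsSubordinator.measurable_leftLim (hζ : IsSubordinator ζ μ) (v : ℝ≥0) :
    Measurable fun ω ↦ Function.leftLim (fun t ↦ ζ t ω) v := by
  rcases eq_or_ne v 0 with rfl | hv
  · simp only [hζ.leftLim_zero]
    exact measurable_const
  · exact measurable_of_tendsto_metrizable (fun n ↦ hζ.measurable _)
      (tendsto_pi_nhds.2 fun ω ↦ hζ.tendsto_leftLim (pos_iff_ne_zero.2 hv) ω)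

/-- A subordinator has no fixed times of discontinuity. -/
theorem IsSubordinator.leftLim_ae_eq [IsProbabilityMeasure μ] (hζ : IsSubordinator ζ μ) (v : ℝ≥0) :
    ∀ᵐ ω ∂μ, Function.leftLim (fun t ↦ ζ t ω) v = ζ v ω := by
  rcases eq_or_ne v 0 with rfl | hv
  · exact ae_of_all _ fun ω ↦ by rw [hζ.leftLim_zero, hζ.zero]
  have hv : 0 < v := pos_iff_ne_zero.2 hv
  have hm := hζ.measurable_leftLim v
  have hm' := hζ.measurable
  have hle : ∀ n : ℕ, v / (n + 1) ≤ v := fun n ↦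
    div_le_self zero_le (by simp)
  have hb : ∀ {x : ℝ}, 0 ≤ x → ‖Real.exp (-x)‖ ≤ 1 := fun hx ↦ by
    rw [Real.norm_eq_abs, Real.abs_exp]
    exact Real.exp_le_one_iff.2 (by linarith)
  have hl : ∀ ω, 0 ≤ ζ v ω - Function.leftLim (fun t ↦ ζ t ω) v := fun ω ↦
    sub_nonneg.2 ((hζ.mono ω).leftLim_le le_rfl)
  -- The Laplace transform at `1` of the increment over `[v - v/(n+1), v]` tends to that of the jump
  -- at `v`. By stationarity it is also that of `ζ_{v/(n+1)}`, which tends to `1` by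
  -- right-continuity at `0`. Hence the nonnegative variable `1 - exp(-jump)` has mean zero.
  have h1 : Tendsto (fun n : ℕ ↦ ∫ ω, Real.exp (-(ζ v ω - ζ (v - v / (n + 1)) ω)) ∂μ) atTop
      (𝓝 (∫ ω, Real.exp (-(ζ v ω - Function.leftLim (fun t ↦ ζ t ω) v)) ∂μ)) := by
    refine tendsto_integral_of_dominated_convergence (fun _ ↦ 1) (fun n ↦ ?_)
      (integrable_const 1) (fun n ↦ ae_of_all _ fun ω ↦ hb ?_) (ae_of_all _ fun ω ↦ ?_)
    · exact Measurable.aestronglyMeasurable (by fun_prop)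
    · exact sub_nonneg.2 (hζ.mono ω tsub_le_self)
    · exact (Real.continuous_exp.tendsto _).comp
        (tendsto_const_nhds.sub (hζ.tendsto_leftLim hv ω)).neg
  have h2 : Tendsto (fun n : ℕ ↦ ∫ ω, Real.exp (-(ζ v ω - ζ (v - v / (n + 1)) ω)) ∂μ) atTop
      (𝓝 (∫ ω, 1 ∂μ)) := by
    have : ∀ n : ℕ, ∫ ω, Real.exp (-(ζ v ω - ζ (v - v / (n + 1)) ω)) ∂μ
        = ∫ ω, Real.exp (-(ζ (v / (n + 1)) ω)) ∂μ := fun n ↦ by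
      have := hζ.stationary (v - v / (n + 1)) (v / (n + 1))
      rw [tsub_add_cancel_of_le (hle n)] at this
      exact (this.comp (u := fun x ↦ Real.exp (-x)) (by fun_prop)).integral_eq
    simp_rw [this]
    refine tendsto_integral_of_dominated_convergence (fun _ ↦ 1) (fun n ↦ ?_)
      (integrable_const 1) (fun n ↦ ae_of_all _ fun ω ↦ hb (hζ.nonneg _ _))
      (ae_of_all _ fun ω ↦ ?_)
    · exact Measurable.aestronglyMeasurable (by fun_prop)
    · have h0 : Tendsto (fun n : ℕ ↦ v / ((n : ℝ≥0) + 1)) atTop (𝓝[≥] 0) := by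
        refine tendsto_nhdsWithin_iff.2 ⟨?_, .of_forall fun n ↦ Set.mem_Ici.2 zero_le⟩
        have h := (tendsto_one_div_add_atTop_nhds_zero_nat (𝕜 := ℝ≥0)).const_mul v
        simpa [div_eq_mul_inv] using h
      have := ((hζ.cadlag ω 0).1.tendsto.comp h0).neg.rexp
      simpa [hζ.zero ω, Function.comp_def] using this
  have h3 := tendsto_nhds_unique h1 h2
  have hint : Integrable
      (fun ω ↦ Real.exp (-(ζ v ω - Function.leftLim (fun t ↦ ζ t ω) v))) μ :=
    Integrable.of_bound (Measurable.aestronglyMeasurable (by fun_prop)) 1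
      (ae_of_all _ fun ω ↦ hb (hl ω))
  have h4 : ∫ ω, (1 - Real.exp (-(ζ v ω - Function.leftLim (fun t ↦ ζ t ω) v))) ∂μ = 0 := by
    rw [integral_sub (integrable_const 1) hint, h3, sub_self]
  have h5 := (integral_eq_zero_iff_of_nonneg (fun ω ↦ by
    simp only [Pi.zero_apply, Pi.sub_apply, sub_nonneg]
    exact Real.exp_le_one_iff.2 (by linarith [hl ω])) ((integrable_const 1).sub hint)).1 h4
  filter_upwards [h5] with ω hω
  have : Real.exp (-(ζ v ω - Function.leftLim (fun t ↦ ζ t ω) v)) = 1 := by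
    simp only [Pi.zero_apply, Pi.sub_apply] at hω
    linarith
  rw [Real.exp_eq_one_iff] at this
  linarith

/-- A two-sided version of the subordinator, vanishing at `0`: on the negative half-line it runs
through the left limits of an independent copy. -/
noncomputable def twoSided {Ω : Type*} (ζ : ℝ≥0 → Ω → ℝ) (r : ℝ) (p : Ω × Ω) : ℝ :=
  ζ r.toNNReal p.1 - Function.leftLim (fun v ↦ ζ v p.2) (-r).toNNReal

theorem IsSubordinator.measurable_twoSided (hζ : IsSubordinator ζ μ) (r : ℝ) :
    Measurable (twoSided ζ r) :=
  ((hζ.measurable _).comp measurable_fst).sub ((hζ.measurable_leftLim _).comp measurable_snd)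

theorem IsSubordinator.monotone_twoSided (hζ : IsSubordinator ζ μ) (p : Ω × Ω) :
    Monotone fun r ↦ twoSided ζ r p := fun _ _ hrs ↦
  sub_le_sub (hζ.mono _ (Real.toNNReal_le_toNNReal hrs))
    ((hζ.mono _).leftLim (Real.toNNReal_le_toNNReal (neg_le_neg hrs)))

/-- Reversing time turns right-continuity into left-continuity; taking left limits of the second
copy is what makes the clock right-continuous on the negative half-line. -/
theorem IsSubordinator.continuousWithinAt_twoSided (hζ : IsSubordinator ζ μ) (p : Ω × Ω) (r : ℝ) :
    ContinuousWithinAt (fun r ↦ twoSided ζ r p) (Set.Ici r) r := by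
  refine ContinuousWithinAt.sub ?_ ?_
  · exact (hζ.cadlag p.1 _).1.comp continuous_real_toNNReal.continuousWithinAt
      fun s hs ↦ Real.toNNReal_le_toNNReal hs
  · exact (continuousWithinAt_leftLim_Iic ((hζ.mono p.2).tendsto_leftLim _)).comp
      (continuous_real_toNNReal.comp continuous_neg).continuousWithinAt
      fun s hs ↦ Real.toNNReal_le_toNNReal (neg_le_neg hs)

/-- Seen from time `-A`, the two-sided subordinator has the law of the subordinator. -/
theorem IsSubordinator.identDistrib_twoSided [IsProbabilityMeasure μ] (hζ : IsSubordinator ζ μ)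
    (A : ℝ≥0) :
    IdentDistrib (fun p (u : ℝ≥0) ↦ twoSided ζ (u - A) p - twoSided ζ (-A) p)
      (fun ω u ↦ ζ u ω) (μ.prod μ) μ := by
  have hm := hζ.measurable
  -- `D` is the re-based clock with values in place of left limits. Truncated subtraction encodes
  -- the two regimes: up to `A` only the second copy moves, read backwards, and after `A` only the
  -- first.
  set D : ℝ≥0 → Ω × Ω → ℝ := fun u p ↦ ζ (u - A) p.1 + (ζ A p.2 - ζ (A - u) p.2) with hD
  have hDm : ∀ u, Measurable (D u) := fun u ↦ by fun_prop
  have h1 : IdentDistrib (fun p u ↦ D u p) (fun ω u ↦ ζ u ω) (μ.prod μ) μ := by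
    refine identDistrib_path_of_increments hDm hm ?_ hζ.indep ?_ hζ.zero fun s h ↦ ?_
    · intro n t ht
      -- The increments of `D` are sums of increments of the two copies; those of the second come
      -- from the reversed partition and are reindexed by `Fin.rev`.
      have hα := hζ.indep n (fun i ↦ t i - A) (fun i j hij ↦ tsub_le_tsub_right (ht hij) A)
      have hβ := (hζ.indep n (fun i ↦ A - t i.rev)
        (fun i j hij ↦ tsub_le_tsub_left (ht (Fin.rev_le_rev.2 hij)) A)).precomp
        (g := Fin.rev) Fin.rev_injective
      have := iIndepFun_add_prod (fun k ↦ by fun_prop) (fun k ↦ by fun_prop) hα hβ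
      convert this using 3 with k p
      simp only [hD, Fin.rev_succ, Fin.rev_castSucc, Fin.rev_rev]
      ring
    · intro p
      simp [hD, hζ.zero]
    · have e1 : s + h - A = (s - A) + ((s + h - A) - (s - A)) :=
        (add_tsub_cancel_of_le (tsub_le_tsub_right le_self_add A)).symm
      have e2 : A - s = (A - (s + h)) + ((A - s) - (A - (s + h))) :=
        (add_tsub_cancel_of_le (tsub_le_tsub_left le_self_add A)).symm
      -- `h₁` and `h₂` are the lengths of the parts of `[s, s + h]` after and before `A`.
      set h₁ := (s + h - A) - (s - A)
      set h₂ := (A - s) - (A - (s + h))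
      have e3 : h₁ + h₂ = h := by
        rcases le_total s A with hs | hs
        · rcases le_total (s + h) A with hs' | hs'
          · have : h₁ = 0 := by simp [h₁, tsub_eq_zero_of_le hs, tsub_eq_zero_of_le hs']
            have h6 : (A - (s + h)) + h = A - s := by
              rw [← tsub_tsub, tsub_add_cancel_of_le]
              exact le_tsub_of_add_le_left hs'
            have h7 := h6.trans e2
            rw [this, zero_add]
            exact (add_left_cancel h7).symm
          · have h8 : h₁ = s + h - A := by simp [h₁, tsub_eq_zero_of_le hs]
            have h9 : h₂ = A - s := by simp [h₂, tsub_eq_zero_of_le hs']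
            rw [h8, h9]
            refine NNReal.eq ?_
            rw [NNReal.coe_add, NNReal.coe_sub hs', NNReal.coe_sub hs]
            push_cast
            ring
        · have hs' : A ≤ s + h := hs.trans le_self_add
          have : h₂ = 0 := by simp [h₂, tsub_eq_zero_of_le hs, tsub_eq_zero_of_le hs']
          rw [this, add_zero]
          refine NNReal.eq ?_
          rw [NNReal.coe_sub (tsub_le_tsub_right le_self_add A), NNReal.coe_sub hs',
            NNReal.coe_sub hs]
          push_cast
          ring
      refine IdentDistrib.trans ?_ (hζ.stationary s h).symm
      rw [← e3]
      refine IdentDistrib.trans ?_ (hζ.identDistrib_add h₁ h₂)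
      rw [e3]
      have i1 : IdentDistrib (fun x : Ω × Ω ↦ ζ (s + h - A) x.1 - ζ (s - A) x.1)
          (fun x : Ω × Ω ↦ ζ h₁ x.1) (μ.prod μ) (μ.prod μ) := by
        have := (hζ.stationary (s - A) h₁)
        rw [← e1] at this
        refine ⟨by fun_prop, by fun_prop, ?_⟩
        have e := this.map_eq
        rw [← Measure.fst_prod (μ := μ) (ν := μ), Measure.fst,
          Measure.map_map (by fun_prop) measurable_fst,
          Measure.map_map (by fun_prop) measurable_fst] at e
        exact e
      have i2 : IdentDistrib (fun x : Ω × Ω ↦ ζ (A - s) x.2 - ζ (A - (s + h)) x.2)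
          (fun x : Ω × Ω ↦ ζ h₂ x.2) (μ.prod μ) (μ.prod μ) := by
        have := (hζ.stationary (A - (s + h)) h₂)
        rw [← e2] at this
        refine ⟨by fun_prop, by fun_prop, ?_⟩
        have e := this.map_eq
        rw [← Measure.snd_prod (μ := μ) (ν := μ), Measure.snd,
          Measure.map_map (by fun_prop) measurable_snd,
          Measure.map_map (by fun_prop) measurable_snd] at e
        exact e
      have := (i1.prodMk i2
        (indepFun_prod (X := fun ω ↦ ζ (s + h - A) ω - ζ (s - A) ω)
          (Y := fun ω ↦ ζ (A - s) ω - ζ (A - (s + h)) ω) (by fun_prop) (by fun_prop))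
        (indepFun_prod (hm h₁) (hm h₂))).comp
        (u := fun x : ℝ × ℝ ↦ x.1 + x.2) (by fun_prop)
      convert this using 1
      · ext p
        simp only [hD, Function.comp]
        ring
      · rfl
  -- Almost sure equality at each fixed time suffices for equal laws on path space, and it holds
  -- because `ζ` has no fixed jump times.
  refine IdentDistrib.trans ⟨?_, (measurable_pi_lambda _ hDm).aemeasurable, ?_⟩ h1
  · exact (measurable_pi_lambda _ fun u ↦
      (hζ.measurable_twoSided _).sub (hζ.measurable_twoSided _)).aemeasurable
  · refine map_eq_of_forall_ae_eq (X := fun (u : ℝ≥0) p ↦ twoSided ζ (u - A) p - twoSided ζ (-A) p)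
      (Y := D) (measurable_pi_lambda _ fun u ↦
        (hζ.measurable_twoSided _).sub (hζ.measurable_twoSided _)).aemeasurable
      (measurable_pi_lambda _ hDm).aemeasurable fun u ↦ ?_
    have hsnd := Measure.quasiMeasurePreserving_snd (μ := μ) (ν := μ)
    filter_upwards [hsnd.ae (hζ.leftLim_ae_eq A), hsnd.ae (hζ.leftLim_ae_eq (A - u))] with p h2 h3
    have t1 : ((u : ℝ) - A).toNNReal = u - A := by
      rw [NNReal.sub_def]
    have t2 : (-((u : ℝ) - A)).toNNReal = A - u := by
      rw [NNReal.sub_def, neg_sub]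
    have t3 : (-(A : ℝ)).toNNReal = 0 := Real.toNNReal_of_nonpos (by simp)
    simp only [twoSided, hD, t1, t2, t3, neg_neg, Real.toNNReal_coe, h2, h3, hζ.zero]
    ring

end Subordinator


/-! ### Path regularity of the time change -/

section Cadlag

/-- A càdlàg path run along a nondecreasing right-continuous clock has left limits. -/
theorem exists_tendsto_comp_monotone {z : ℝ≥0 → ℝ} (hz : ∀ t, IsCadlagAt z t) {G : ℝ → ℝ≥0}
    (hG : Monotone G) (r : ℝ) : ∃ l : ℝ, Tendsto (fun s ↦ z (G s)) (𝓝[<] r) (𝓝 l) := by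
  set L := Function.leftLim G r
  have hL : Tendsto G (𝓝[<] r) (𝓝 L) := hG.tendsto_leftLim r
  -- If `G` attains its left limit before `r`, it is constant just before `r`. Otherwise it
  -- approaches `L` strictly from below, and the left limit of `z` at `L` applies.
  by_cases h : ∃ s < r, G s = L
  · obtain ⟨s, hs, hsL⟩ := h
    refine ⟨z L, tendsto_const_nhds.congr' ?_⟩
    filter_upwards [Ioo_mem_nhdsLT hs] with u hu
    have h1 : L ≤ G u := hsL ▸ hG hu.1.le
    rw [le_antisymm (hG.le_leftLim hu.2) h1]
  · push Not at h
    obtain ⟨l, hl⟩ := (hz L).2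
    refine ⟨l, hl.comp (tendsto_nhdsWithin_iff.2 ⟨hL, ?_⟩)⟩
    filter_upwards [self_mem_nhdsWithin] with u hu
    exact lt_of_le_of_ne (hG.le_leftLim hu) (h u hu)

theorem tendsto_log_nhdsLT {t : ℝ≥0} (ht : 0 < t) :
    Tendsto (fun s : ℝ≥0 ↦ Real.log s) (𝓝[<] t) (𝓝[<] (Real.log t)) := by
  refine tendsto_nhdsWithin_iff.2 ⟨?_, ?_⟩
  · exact ((Real.continuousAt_log (NNReal.coe_ne_zero.2 ht.ne')).tendsto.comp
      NNReal.continuous_coe.continuousAt).mono_left nhdsWithin_le_nhds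
  · filter_upwards [Ioo_mem_nhdsLT ht] with s hs
    exact Real.log_lt_log (NNReal.coe_pos.2 hs.1) (NNReal.coe_lt_coe.2 hs.2)

theorem tendsto_log_nhdsGE {t : ℝ≥0} (ht : 0 < t) :
    Tendsto (fun s : ℝ≥0 ↦ Real.log s) (𝓝[≥] t) (𝓝[≥] (Real.log t)) := by
  refine tendsto_nhdsWithin_iff.2 ⟨?_, ?_⟩
  · exact ((Real.continuousAt_log (NNReal.coe_ne_zero.2 ht.ne')).tendsto.comp
      NNReal.continuous_coe.continuousAt).mono_left nhdsWithin_le_nhds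
  · filter_upwards [self_mem_nhdsWithin] with s hs
    exact Real.log_le_log (NNReal.coe_pos.2 ht) (NNReal.coe_le_coe.2 hs)

/-- From the right, a monotone right-continuous clock approaches its value from above, so
right-continuity of `z` is enough. From the left, the clock may stall or jump, which
`exists_tendsto_comp_monotone` covers. -/
theorem isCadlagAt_timeChange (κ : ℝ) {z : ℝ≥0 → ℝ} (hz : ∀ t, IsCadlagAt z t) {W : ℝ → ℝ}
    (hW : Monotone W) (hWr : ∀ r, ContinuousWithinAt W (Set.Ici r) r) {t : ℝ≥0} (ht : 0 < t) :
    IsCadlagAt (fun t : ℝ≥0 ↦ (t : ℝ) ^ κ * Real.exp (-κ * W (Real.log t))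
      * z (Real.exp (W (Real.log t))).toNNReal) t := by
  have hpow : Tendsto (fun s : ℝ≥0 ↦ (s : ℝ) ^ κ) (𝓝 t) (𝓝 ((t : ℝ) ^ κ)) :=
    (Real.continuousAt_rpow_const _ _ (Or.inl (NNReal.coe_ne_zero.2 ht.ne'))).tendsto.comp
      NNReal.continuous_coe.continuousAt
  have hG : Monotone fun r ↦ (Real.exp (W r)).toNNReal := fun _ _ h ↦
    Real.toNNReal_le_toNNReal (Real.exp_le_exp.2 (hW h))
  have hcont : Continuous fun x : ℝ ↦ (Real.exp x).toNNReal := by fun_prop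
  have hWl := tendsto_log_nhdsGE ht
  constructor
  · refine ((hpow.mono_left nhdsWithin_le_nhds).mul ?_).mul ?_
    · exact ((((hWr _).tendsto.comp hWl).const_mul (-κ))).rexp
    · refine (hz _).1.tendsto.comp (tendsto_nhdsWithin_iff.2 ⟨?_, ?_⟩)
      · exact (hcont.tendsto _).comp ((hWr _).tendsto.comp hWl)
      · filter_upwards [hWl.eventually self_mem_nhdsWithin] with s hs
        exact hG hs
  · obtain ⟨l, hl⟩ := exists_tendsto_comp_monotone hz hG (Real.log t)
    exact ⟨_, ((hpow.mono_left nhdsWithin_le_nhds).mul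
      (((hW.tendsto_leftLim _).comp (tendsto_log_nhdsLT ht)).const_mul (-κ)).rexp).mul
      (hl.comp (tendsto_log_nhdsLT ht))⟩

end Cadlag

/-! ### Finite-dimensional laws of the time changes -/

section Laws

theorem identDistrib_comp_fst {Ω Ω' E : Type*} [MeasurableSpace Ω] [MeasurableSpace Ω']
    [MeasurableSpace E] {μ : Measure Ω} {ν : Measure Ω'} [IsProbabilityMeasure μ]
    [IsProbabilityMeasure ν] {f : Ω → E} (hf : Measurable f) :
    IdentDistrib (fun p : Ω × Ω' ↦ f p.1) f (μ.prod ν) μ :=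
  ⟨(hf.comp measurable_fst).aemeasurable, hf.aemeasurable, by
    rw [show (fun p : Ω × Ω' ↦ f p.1) = f ∘ Prod.fst from rfl, ← Measure.map_map hf measurable_fst,
      Measure.map_fst_prod, measure_univ, one_smul]⟩

theorem identDistrib_comp_snd {Ω Ω' E : Type*} [MeasurableSpace Ω] [MeasurableSpace Ω']
    [MeasurableSpace E] {μ : Measure Ω} {ν : Measure Ω'} [IsProbabilityMeasure μ]
    [IsProbabilityMeasure ν] {f : Ω' → E} (hf : Measurable f) :
    IdentDistrib (fun p : Ω × Ω' ↦ f p.2) f (μ.prod ν) ν :=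
  ⟨(hf.comp measurable_snd).aemeasurable, hf.aemeasurable, by
    rw [show (fun p : Ω × Ω' ↦ f p.2) = f ∘ Prod.snd from rfl, ← Measure.map_map hf measurable_snd,
      Measure.map_snd_prod, measure_univ, one_smul]⟩

theorem IsSelfSimilar.comp_snd {Ω Ω' : Type*} [MeasurableSpace Ω] [MeasurableSpace Ω']
    {μ : Measure Ω} {ν : Measure Ω'} [IsProbabilityMeasure μ] [IsProbabilityMeasure ν] {κ : ℝ}
    {Z : ℝ≥0 → Ω' → ℝ} (hZ : ∀ t, Measurable (Z t)) (h : IsSelfSimilar κ Z ν) :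
    IsSelfSimilar κ (fun t (p : Ω × Ω') ↦ Z t p.2) (μ.prod ν) := fun c hc I hI ↦ by
  have h1 : Measurable fun ω (i : I) ↦ Z (c * i) ω := by fun_prop
  have h2 : Measurable fun ω (i : I) ↦ (c : ℝ) ^ κ * Z i ω := by fun_prop
  exact (identDistrib_comp_snd h1).trans ((h c hc I hI).trans (identDistrib_comp_snd h2).symm)

/-- This reduces finite-dimensional statements on `(0,∞)` to a single process `X^{(a)}`. -/
theorem exists_exp_neg_le (I : Finset ℝ≥0) : ∃ a : ℝ, ∀ i ∈ I, 0 < i → Real.exp (-a) ≤ i := by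
  refine ⟨∑ i ∈ I, |Real.log i|, fun i hi hpos ↦ ?_⟩
  have h1 : |Real.log i| ≤ ∑ i ∈ I, |Real.log (i : ℝ≥0)| :=
    Finset.single_le_sum (f := fun i : ℝ≥0 ↦ |Real.log i|) (fun _ _ ↦ abs_nonneg _) hi
  have h2 := neg_abs_le (Real.log i)
  rw [← Real.le_log_iff_exp_le (NNReal.coe_pos.2 hpos)]
  linarith

theorem SameFDD.mono {Ω Ω' : Type*} [MeasurableSpace Ω] [MeasurableSpace Ω'] {μ : Measure Ω}
    {ν : Measure Ω'} {S T : Set ℝ≥0} {X : ℝ≥0 → Ω → ℝ} {Y : ℝ≥0 → Ω' → ℝ} (h : SameFDD T X μ Y ν)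
    (hST : S ⊆ T) : SameFDD S X μ Y ν := fun I hI ↦ h I (hI.trans hST)

theorem SameFDD.trans {Ω Ω' Ω'' : Type*} [MeasurableSpace Ω] [MeasurableSpace Ω']
    [MeasurableSpace Ω''] {μ : Measure Ω} {ν : Measure Ω'} {ρ : Measure Ω''} {T : Set ℝ≥0}
    {X : ℝ≥0 → Ω → ℝ} {Y : ℝ≥0 → Ω' → ℝ} {V : ℝ≥0 → Ω'' → ℝ} (h : SameFDD T X μ Y ν)
    (h' : SameFDD T Y ν V ρ) : SameFDD T X μ V ρ := fun I hI ↦ (h I hI).trans (h' I hI)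

theorem SameFDD.symm {Ω Ω' : Type*} [MeasurableSpace Ω] [MeasurableSpace Ω'] {μ : Measure Ω}
    {ν : Measure Ω'} {T : Set ℝ≥0} {X : ℝ≥0 → Ω → ℝ} {Y : ℝ≥0 → Ω' → ℝ} (h : SameFDD T X μ Y ν) :
    SameFDD T Y ν X μ := fun I hI ↦ (h I hI).symm

theorem SameFDD.trans_eq {Ω Ω' : Type*} [MeasurableSpace Ω] [MeasurableSpace Ω'] {μ : Measure Ω}
    {ν : Measure Ω'} {T : Set ℝ≥0} {X : ℝ≥0 → Ω → ℝ} {Y V : ℝ≥0 → Ω' → ℝ} (h : SameFDD T X μ Y ν)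
    (h' : ∀ t ∈ T, ∀ ω, Y t ω = V t ω) : SameFDD T X μ V ν := fun I hI ↦ by
  convert h I hI using 1
  ext ω i
  exact (h' i (hI i.2) ω).symm

theorem SameFDD.const_mul {Ω Ω' : Type*} [MeasurableSpace Ω] [MeasurableSpace Ω'] {μ : Measure Ω}
    {ν : Measure Ω'} {T : Set ℝ≥0} {X : ℝ≥0 → Ω → ℝ} {Y : ℝ≥0 → Ω' → ℝ} (h : SameFDD T X μ Y ν)
    (c : ℝ) : SameFDD T (fun t ω ↦ c * X t ω) μ (fun t ω ↦ c * Y t ω) ν := fun I hI ↦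
  (h I hI).comp (u := fun (x : I → ℝ) i ↦ c * x i) (by fun_prop)

theorem SameFDD.comp_mul {Ω Ω' : Type*} [MeasurableSpace Ω] [MeasurableSpace Ω'] {μ : Measure Ω}
    {ν : Measure Ω'} {S T : Set ℝ≥0} {X : ℝ≥0 → Ω → ℝ} {Y : ℝ≥0 → Ω' → ℝ} (h : SameFDD T X μ Y ν)
    {c : ℝ≥0} (hc : ∀ t ∈ S, c * t ∈ T) :
    SameFDD S (fun t ↦ X (c * t)) μ (fun t ↦ Y (c * t)) ν := fun I hI ↦ by
  classical
  exact (h (I.image (c * ·)) (by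
    intro j hj
    obtain ⟨i, hi, rfl⟩ := Finset.mem_image.1 hj
    exact hc i (hI hi))).comp
    (u := fun (x : I.image (c * ·) → ℝ) (i : I) ↦ x ⟨c * i, Finset.mem_image_of_mem _ i.2⟩)
    (by fun_prop)

/-- Finite-dimensional distributions of processes which vanish at time `0` are determined by those
at positive times. -/
theorem SameFDD.univ_of_zero {Ω Ω' : Type*} [MeasurableSpace Ω] [MeasurableSpace Ω']
    {μ : Measure Ω} {ν : Measure Ω'} {X : ℝ≥0 → Ω → ℝ} {Y : ℝ≥0 → Ω' → ℝ}
    (hX : ∀ ω, X 0 ω = 0) (hY : ∀ ω, Y 0 ω = 0)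
    (h : ∀ a : ℝ, SameFDD {t : ℝ≥0 | Real.exp (-a) ≤ t} X μ Y ν) : SameFDD Set.univ X μ Y ν := by
  classical
  intro I _
  obtain ⟨a, ha⟩ := exists_exp_neg_le I
  have hJ := h a (I.filter (0 < ·)) (fun i hi ↦ ha i (Finset.mem_filter.1 hi).1
    (Finset.mem_filter.1 hi).2)
  -- A missing coordinate can only belong to time `0`, where both processes vanish, so the default
  -- `0` is the true value.
  have := hJ.comp (u := fun (x : I.filter (0 < ·) → ℝ) (i : I) ↦
    if hi : (i : ℝ≥0) ∈ I.filter (0 < ·) then x ⟨i, hi⟩ else 0) (by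
      refine measurable_pi_lambda _ fun i ↦ ?_
      split_ifs
      · exact measurable_pi_apply _
      · exact measurable_const)
  have h0 : ∀ i : I, (i : ℝ≥0) ∉ I.filter (0 < ·) → (i : ℝ≥0) = 0 := fun i hi ↦ by
    by_contra hne
    exact hi (Finset.mem_filter.2 ⟨i.2, pos_iff_ne_zero.2 hne⟩)
  convert this using 1
  · ext ω i
    simp only [Function.comp]
    split_ifs with hi
    · rfl
    · rw [h0 i hi, hX]
  · ext ω i
    simp only [Function.comp]
    split_ifs with hi
    · rfl
    · rw [h0 i hi, hY]

/-- The time change of `Z` (on the last factor) by the two-sided subordinator (on the first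
factors). -/
noncomputable def timeChangeTwoSided {Ω : Type*} (κ : ℝ) (ζ Z : ℝ≥0 → Ω → ℝ) (t : ℝ≥0)
    (p : (Ω × Ω) × Ω) : ℝ :=
  (t : ℝ) ^ κ * Real.exp (-κ * twoSided ζ (Real.log t) p.1)
    * Z (Real.exp (twoSided ζ (Real.log t) p.1)).toNNReal p.2

theorem measurable_timeChangeTwoSided {Ω : Type*} [MeasurableSpace Ω] {μ : Measure Ω} {κ : ℝ}
    {ζ Z : ℝ≥0 → Ω → ℝ} (hZ : ∀ t, Measurable (Z t))
    (hr : ∀ ω t, ContinuousWithinAt (fun t ↦ Z t ω) (Set.Ici t) t) (hζ : IsSubordinator ζ μ)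
    (t : ℝ≥0) : Measurable (timeChangeTwoSided κ ζ Z t) := by
  have hm := hζ.measurable_twoSided (Real.log t)
  refine Measurable.mul (by fun_prop) ?_
  exact (measurable_of_rightContinuous hZ hr).comp
    (f := fun p : (Ω × Ω) × Ω ↦ (p.2, (Real.exp (twoSided ζ (Real.log t) p.1)).toNNReal))
    (by fun_prop)

/-- The factor `0 ^ κ` vanishes, so time `0` needs no separate definition, whatever the default
value of `Real.log 0`. -/
theorem timeChangeTwoSided_zero {Ω : Type*} {κ : ℝ} {ζ Z : ℝ≥0 → Ω → ℝ} (hκ : 0 < κ)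
    (p : (Ω × Ω) × Ω) : timeChangeTwoSided κ ζ Z 0 p = 0 := by
  simp [timeChangeTwoSided, Real.zero_rpow hκ.ne']

variable {Ω : Type*} [MeasurableSpace Ω] {μ : Measure Ω} [IsProbabilityMeasure μ] {κ : ℝ}
  {ζ Z : ℝ≥0 → Ω → ℝ}

theorem log_add_nonneg {a : ℝ} {t : ℝ≥0} (ht : Real.exp (-a) ≤ t) : 0 ≤ a + Real.log t := by
  have := (Real.le_log_iff_exp_le ((Real.exp_pos _).trans_le ht)).2 ht
  linarith

theorem pos_of_exp_le {a : ℝ} {t : ℝ≥0} (ht : Real.exp (-a) ≤ t) : 0 < t :=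
  NNReal.coe_pos.1 ((Real.exp_pos _).trans_le ht)

/-- Each `X^{(a)}` has the one-dimensional marginals of `Z`. -/
theorem identDistrib_timeChange_marginal (hZ : ∀ t, Measurable (Z t))
    (hr : ∀ ω t, ContinuousWithinAt (fun t ↦ Z t ω) (Set.Ici t) t) (hs : IsSelfSimilar κ Z μ)
    (hζ : IsSubordinator ζ μ) (hind : IndepFun (fun ω t ↦ ζ t ω) (fun ω t ↦ Z t ω) μ)
    {a : ℝ} {t : ℝ≥0} (ht : Real.exp (-a) ≤ t) :
    IdentDistrib (timeChange κ ζ Z a t) (Z t) μ μ := by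
  have hm := hζ.measurable
  -- Shifting the single clock by its own value leaves the clock `0`, that is `t ^ κ * Z 1`, which
  -- self-similarity identifies with `Z t` in law.
  have h1 := identDistrib_timeChange_of_shift (ι := Unit) (fun _ ↦ (t : ℝ) ^ κ) hZ hZ hr hr hs hs
    (IdentDistrib.refl (measurable_pi_lambda _ hZ).aemeasurable)
    (W := fun _ ↦ ζ (a + Real.log t).toNNReal) (W' := fun _ _ ↦ 0)
    (H := ζ (a + Real.log t).toNNReal) (H' := fun _ ↦ 0) (fun _ ↦ hm _)
    (fun _ ↦ measurable_const) (hm _) measurable_const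
    (hind.comp (φ := fun (z : ℝ≥0 → ℝ) (_ : Unit) ↦ z (a + Real.log t).toNNReal) (by fun_prop) measurable_id)
    (indepFun_const_left _ _) (by
      simp only [sub_self]
      exact IdentDistrib.refl aemeasurable_const)
  have h2 := h1.comp (u := fun x ↦ x ()) (by fun_prop)
  refine IdentDistrib.trans h2 ?_
  have h3 := (hs.identDistrib hZ (pos_of_exp_le ht)).comp (u := fun z ↦ z 1) (by fun_prop)
  refine IdentDistrib.trans ?_ (h3.symm.trans ?_)
  · simp only [mul_zero, Real.exp_zero, mul_one, Real.toNNReal_one, Function.comp_def]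
    exact IdentDistrib.refl ((hZ 1).const_mul _).aemeasurable
  · simp only [mul_one, Function.comp_def]
    exact IdentDistrib.refl (hZ t).aemeasurable

/-- The processes `X^{(a)}` are consistent in `a`. -/
theorem sameFDD_timeChange (hZ : ∀ t, Measurable (Z t))
    (hr : ∀ ω t, ContinuousWithinAt (fun t ↦ Z t ω) (Set.Ici t) t) (hs : IsSelfSimilar κ Z μ)
    (hζ : IsSubordinator ζ μ) (hind : IndepFun (fun ω t ↦ ζ t ω) (fun ω t ↦ Z t ω) μ)
    {a b : ℝ} (hba : b ≤ a) :
    SameFDD {t : ℝ≥0 | Real.exp (-b) ≤ t} (timeChange κ ζ Z a) μ (timeChange κ ζ Z b) μ := by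
  have hm := hζ.measurable
  refine SameFDD.of_identDistrib ?_
  refine identDistrib_timeChange_of_shift (fun i : {t : ℝ≥0 | Real.exp (-b) ≤ t} ↦ ((i : ℝ≥0) : ℝ) ^ κ) hZ hZ hr hr hs hs
    (IdentDistrib.refl (measurable_pi_lambda _ hZ).aemeasurable)
    (W := fun i : {t : ℝ≥0 | Real.exp (-b) ≤ t} ↦ ζ (a + Real.log (i : ℝ≥0)).toNNReal)
    (W' := fun i ↦ ζ (b + Real.log (i : ℝ≥0)).toNNReal)
    (H := ζ (a - b).toNNReal) (H' := fun _ ↦ 0) (fun _ ↦ hm _)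
    (fun _ ↦ hm _) (hm _) measurable_const
    (hind.comp (φ := fun (z : ℝ≥0 → ℝ) (i : {t : ℝ≥0 | Real.exp (-b) ≤ t}) ↦ z (a + Real.log (i : ℝ≥0)).toNNReal) (by fun_prop) measurable_id)
    (hind.comp (φ := fun (z : ℝ≥0 → ℝ) (i : {t : ℝ≥0 | Real.exp (-b) ≤ t}) ↦ z (b + Real.log (i : ℝ≥0)).toNNReal) (by fun_prop) measurable_id) ?_
  -- The clock of `X^{(a)}` minus `ζ_{a-b}` is the subordinator restarted at `a - b`, which has the
  -- law of the clock of `X^{(b)}`.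
  have := (hζ.identDistrib_shift (a - b).toNNReal).comp
    (u := fun z (i : {t : ℝ≥0 | Real.exp (-b) ≤ t}) ↦ z (b + Real.log (i : ℝ≥0)).toNNReal)
    (by fun_prop)
  simp only [sub_zero]
  convert this using 1
  · ext ω i
    simp only [Function.comp]
    rw [← Real.toNNReal_add (by linarith) (log_add_nonneg i.2)]
    ring_nf
  · rfl

/-- The time change by the two-sided subordinator extends all `X^{(a)}` in law. -/
theorem sameFDD_timeChangeTwoSided (hZ : ∀ t, Measurable (Z t))
    (hr : ∀ ω t, ContinuousWithinAt (fun t ↦ Z t ω) (Set.Ici t) t) (hs : IsSelfSimilar κ Z μ)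
    (hζ : IsSubordinator ζ μ) (hind : IndepFun (fun ω t ↦ ζ t ω) (fun ω t ↦ Z t ω) μ) (a : ℝ) :
    SameFDD {t : ℝ≥0 | Real.exp (-a) ≤ t} (timeChangeTwoSided κ ζ Z) ((μ.prod μ).prod μ)
      (timeChange κ ζ Z a) μ := by
  have hm := hζ.measurable
  have key : ∀ A : ℝ≥0, SameFDD {t : ℝ≥0 | Real.exp (-(A : ℝ)) ≤ t} (timeChangeTwoSided κ ζ Z)
      ((μ.prod μ).prod μ) (timeChange κ ζ Z A) μ := fun A ↦ by
    refine SameFDD.of_identDistrib ?_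
    have hW : ∀ i : {t : ℝ≥0 | Real.exp (-(A : ℝ)) ≤ t},
        Measurable (twoSided ζ (Real.log (i : ℝ≥0))) := fun i ↦ hζ.measurable_twoSided _
    refine identDistrib_timeChange_of_shift (fun i : {t : ℝ≥0 | Real.exp (-(A : ℝ)) ≤ t} ↦ ((i : ℝ≥0) : ℝ) ^ κ)
      (Z := fun t (p : (Ω × Ω) × Ω) ↦ Z t p.2) (fun t ↦ (hZ t).comp measurable_snd)
      hZ (fun p ↦ hr p.2) hr (hs.comp_snd hZ) hs
      (identDistrib_comp_snd (measurable_pi_lambda _ hZ))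
      (W := fun i : {t : ℝ≥0 | Real.exp (-(A : ℝ)) ≤ t} ↦ fun (p : (Ω × Ω) × Ω) ↦
        twoSided ζ (Real.log (i : ℝ≥0)) p.1)
      (W' := fun i ↦ ζ (A + Real.log (i : ℝ≥0)).toNNReal)
      (H := fun p ↦ twoSided ζ (-A) p.1) (H' := fun _ ↦ 0)
      (fun i ↦ (hW i).comp measurable_fst) (fun _ ↦ hm _)
      ((hζ.measurable_twoSided _).comp measurable_fst) measurable_const
      (indepFun_prod (measurable_pi_lambda _ hW) (measurable_pi_lambda _ hZ))
      (hind.comp (φ := fun (z : ℝ≥0 → ℝ) (i : {t : ℝ≥0 | Real.exp (-(A : ℝ)) ≤ t}) ↦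
        z (A + Real.log (i : ℝ≥0)).toNNReal) (by fun_prop)
        measurable_id) ?_
    -- Here the common shift is the value of the two-sided clock at `-A`.
    have h1 := (hζ.identDistrib_twoSided A).comp
      (u := fun z (i : {t : ℝ≥0 | Real.exp (-(A : ℝ)) ≤ t}) ↦ z (A + Real.log (i : ℝ≥0)).toNNReal)
      (by fun_prop)
    have h2 : Measurable fun p (i : {t : ℝ≥0 | Real.exp (-(A : ℝ)) ≤ t}) ↦
        twoSided ζ (Real.log (i : ℝ≥0)) p - twoSided ζ (-A) p :=
      measurable_pi_lambda _ fun i ↦ (hW i).sub (hζ.measurable_twoSided _)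
    refine (identDistrib_comp_fst h2).trans ?_
    simp only [sub_zero]
    convert h1 using 1
    · ext p i
      simp only [Function.comp]
      rw [Real.coe_toNNReal _ (log_add_nonneg i.2), add_sub_cancel_left]
    · rfl
  rcases le_total 0 a with ha | ha
  · have := key a.toNNReal
    rwa [Real.coe_toNNReal a ha] at this
  -- For negative `a` the comparison with `X^{(0)}` and consistency in the parameter suffice.
  · have h0 := key 0
    rw [NNReal.coe_zero] at h0
    refine (h0.mono fun t ht ↦ ?_).trans (sameFDD_timeChange hZ hr hs hζ hind ha)
    exact (Real.exp_le_exp.2 (by linarith)).trans ht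

/-- Scaling time by `c` adds `ln c` to `ln t`, which a change of parameter compensates: `X^{(a - ln
c)}_{ct} = c^κ X^{(a)}_t` holds pathwise, and all the `X^{(a)}` agree in law with one process. -/
theorem isSelfSimilar_timeChangeTwoSided (hκ : 0 < κ) (hZ : ∀ t, Measurable (Z t))
    (hr : ∀ ω t, ContinuousWithinAt (fun t ↦ Z t ω) (Set.Ici t) t) (hs : IsSelfSimilar κ Z μ)
    (hζ : IsSubordinator ζ μ) (hind : IndepFun (fun ω t ↦ ζ t ω) (fun ω t ↦ Z t ω) μ) :
    IsSelfSimilar κ (timeChangeTwoSided κ ζ Z) ((μ.prod μ).prod μ) := by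
  intro c hc
  have hc' : (0 : ℝ) < c := NNReal.coe_pos.2 hc
  refine SameFDD.univ_of_zero (by simp [timeChangeTwoSided_zero hκ])
    (by simp [timeChangeTwoSided_zero hκ]) fun a ↦ ?_
  have h1 := (sameFDD_timeChangeTwoSided hZ hr hs hζ hind a).const_mul ((c : ℝ) ^ κ)
  have h2 := (sameFDD_timeChangeTwoSided hZ hr hs hζ hind (a - Real.log c)).comp_mul
    (c := c) (S := {t : ℝ≥0 | Real.exp (-a) ≤ t}) (fun t ht ↦ by
      have : Real.exp (-(a - Real.log c)) = c * Real.exp (-a) := by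
        rw [neg_sub, sub_eq_add_neg, Real.exp_add, Real.exp_log hc']
      simp only [Set.mem_ofPred_eq, this, NNReal.coe_mul]
      exact mul_le_mul_of_nonneg_left ht hc'.le)
  refine h2.trans (SameFDD.symm ?_)
  refine h1.trans_eq fun t ht ω ↦ ?_
  have ht' : (0 : ℝ) < t := NNReal.coe_pos.2 (pos_of_exp_le ht)
  have : a - Real.log c + Real.log ↑(c * t) = a + Real.log t := by
    rw [NNReal.coe_mul, Real.log_mul hc'.ne' ht'.ne']
    ring
  simp only [timeChange, this]
  rw [NNReal.coe_mul, Real.mul_rpow hc'.le ht'.le]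
  ring

end Laws


/-! ### The randomised kernel as a mixture -/

section Kernel

variable {P : ℝ≥0 → ℝ≥0 → ℝ → Measure ℝ}

/-- The law at time `t` given the state `x` at time `e^{-|r|} t`, as a function of `(r, x)`. -/
noncomputable def backwardKernel (P : ℝ≥0 → ℝ≥0 → ℝ → Measure ℝ) (t : ℝ≥0) (q : ℝ × ℝ) : Measure ℝ :=
  P ((Real.exp (-|q.1|)).toNNReal * t) t q.2

theorem exp_neg_abs_mul_pos {t : ℝ≥0} (ht : 0 < t) (r : ℝ) :
    0 < (Real.exp (-|r|)).toNNReal * t :=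
  mul_pos (Real.toNNReal_pos.2 (Real.exp_pos _)) ht

theorem exp_neg_abs_mul_le (t : ℝ≥0) (r : ℝ) : (Real.exp (-|r|)).toNNReal * t ≤ t :=
  mul_le_of_le_one_left zero_le (Real.toNNReal_le_one.2 (Real.exp_le_one_iff.2 (by simp)))

/-- The absolute value in `backwardKernel` keeps the initial time in `(0, t]` for every real `r`, so
the joint measurability of `P` gives measurability on the whole plane. -/
theorem IsMarkovFamily.measurable_backwardKernel (hP : IsMarkovFamily P) {t : ℝ≥0} (ht : 0 < t) :
    Measurable (backwardKernel P t) :=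
  (hP.measurable t).comp (f := fun q : ℝ × ℝ ↦
    (⟨((Real.exp (-|q.1|)).toNNReal * t, q.2), exp_neg_abs_mul_pos ht _, exp_neg_abs_mul_le t _⟩ :
      {p : ℝ≥0 × ℝ // 0 < p.1 ∧ p.1 ≤ t})) (Measurable.subtype_mk (by fun_prop))

theorem IsMarkovFamily.isProbabilityMeasure_backwardKernel (hP : IsMarkovFamily P) {t : ℝ≥0}
    (ht : 0 < t) (q : ℝ × ℝ) : IsProbabilityMeasure (backwardKernel P t q) :=
  hP.prob _ _ _ (exp_neg_abs_mul_le t _) (Or.inl (exp_neg_abs_mul_pos ht _))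

theorem IsMarkovFamily.measurable_right (hP : IsMarkovFamily P) {s t : ℝ≥0} (hs : 0 < s)
    (hst : s ≤ t) : Measurable (P s t) :=
  (hP.measurable t).comp (f := fun x : ℝ ↦
    (⟨(s, x), hs, hst⟩ : {p : ℝ≥0 × ℝ // 0 < p.1 ∧ p.1 ≤ t})) (Measurable.subtype_mk (by fun_prop))

variable {Ω : Type*} [MeasurableSpace Ω] {μ : Measure Ω} {κ : ℝ} {ζ : ℝ≥0 → Ω → ℝ}

theorem randomisedKernel_eq (hζ : IsSubordinator ζ μ) {s : ℝ≥0} (hs : 0 < s) (t : ℝ≥0) (x : ℝ) :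
    randomisedKernel κ ζ μ P s t x = μ.bind fun ω ↦ backwardKernel P t
      (ζ (Real.log (t / s)).toNNReal ω,
        ((t : ℝ) / s) ^ κ * Real.exp (-κ * ζ (Real.log (t / s)).toNNReal ω) * x) := by
  rw [randomisedKernel, if_neg hs.ne']
  simp only [backwardKernel, abs_of_nonneg (hζ.nonneg _ _)]

theorem lintegral_randomisedKernel (hP : IsMarkovFamily P) (hζ : IsSubordinator ζ μ) {s t : ℝ≥0}
    (hs : 0 < s) (hst : s ≤ t) (x : ℝ) {g : ℝ → ℝ≥0∞} (hg : Measurable g) :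
    ∫⁻ y, g y ∂(randomisedKernel κ ζ μ P s t x) = ∫⁻ ω, ∫⁻ y, g y ∂(backwardKernel P t
      (ζ (Real.log (t / s)).toNNReal ω,
        ((t : ℝ) / s) ^ κ * Real.exp (-κ * ζ (Real.log (t / s)).toNNReal ω) * x)) ∂μ := by
  have hm := hζ.measurable
  rw [randomisedKernel_eq hζ hs, Measure.lintegral_bind _ hg.aemeasurable]
  exact ((hP.measurable_backwardKernel (hs.trans_le hst)).comp (by fun_prop)).aemeasurable

end Kernel

/-! ### The Markov property of `Z`, rescaled to a prescribed terminal time -/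

section Markov

variable {Ω : Type*} [MeasurableSpace Ω] {μ : Measure Ω} [IsProbabilityMeasure μ] {κ : ℝ}
  {Z : ℝ≥0 → Ω → ℝ} {P : ℝ≥0 → ℝ≥0 → ℝ → Measure ℝ}

theorem measurable_natural {Ω : Type*} [MeasurableSpace Ω] {Z : ℝ≥0 → Ω → ℝ}
    (hZ : ∀ t, StronglyMeasurable (Z t)) {u s : ℝ≥0} (hus : u ≤ s) :
    Measurable[Filtration.natural Z hZ s] (Z u) :=
  ((Filtration.stronglyAdapted_natural hZ u).mono ((Filtration.natural Z hZ).mono hus)).measurable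

theorem lintegral_indicator_one_mul {Ω E : Type*} [MeasurableSpace Ω] {μ : Measure Ω}
    {V : Ω → E} {C : Set E} (hC : MeasurableSet (V ⁻¹' C)) (f : Ω → ℝ≥0∞) :
    ∫⁻ ω, C.indicator 1 (V ω) * f ω ∂μ = ∫⁻ ω in V ⁻¹' C, f ω ∂μ := by
  rw [← lintegral_indicator hC]
  refine lintegral_congr fun ω ↦ ?_
  by_cases h : V ω ∈ C
  · simp [Set.indicator, h]
  · simp [Set.indicator, h]

/-- The Markov property for nonnegative functions. -/
theorem IsMarkovProcess.setLIntegral_eq {hZ : ∀ t, StronglyMeasurable (Z t)}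
    (h : IsMarkovProcess Z hZ P μ) {s t : ℝ≥0} (hs : 0 < s) (hst : s ≤ t) {A : Set Ω}
    (hA : MeasurableSet[Filtration.natural Z hZ s] A) {g : ℝ → ℝ≥0∞} (hg : Measurable g) :
    ∫⁻ ω in A, g (Z t ω) ∂μ = ∫⁻ ω in A, ∫⁻ y, g y ∂(P s t (Z s ω)) ∂μ := by
  have hA' : MeasurableSet A := (Filtration.natural Z hZ).le s _ hA
  have hk : Measurable fun ω ↦ P s t (Z s ω) :=
    (h.family.measurable_right hs hst).comp (hZ s).measurable
  have hprob : ∀ ω, IsProbabilityMeasure (P s t (Z s ω)) := fun ω ↦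
    h.family.prob s t _ hst (Or.inl hs)
  -- The conditional expectation identity for indicators is an equality of measures, which then
  -- integrates every nonnegative function.
  have key : (μ.restrict A).map (Z t) = (μ.restrict A).bind fun ω ↦ P s t (Z s ω) := by
    ext B hB
    rw [Measure.map_apply (hZ t).measurable hB, Measure.bind_apply hB hk.aemeasurable]
    have h1 := h.markov s t hst (B.indicator 1) (measurable_one.indicator hB)
      ⟨1, fun y ↦ by by_cases hy : y ∈ B <;> simp [hy]⟩
    have hint : Integrable (fun ω ↦ B.indicator (1 : ℝ → ℝ) (Z t ω)) μ :=
      Integrable.of_bound ((measurable_one.indicator hB).comp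
        (hZ t).measurable).aestronglyMeasurable 1
        (ae_of_all _ fun ω ↦ by by_cases hy : Z t ω ∈ B <;> simp [hy])
    have h2 := setIntegral_condExp ((Filtration.natural Z hZ).le s) hint hA
    rw [setIntegral_congr_ae hA' (h1.mono fun ω hω _ ↦ hω)] at h2
    simp only [integral_indicator_one hB] at h2
    have h3 : (fun ω ↦ B.indicator (1 : ℝ → ℝ) (Z t ω)) = (Z t ⁻¹' B).indicator 1 := by
      ext ω
      by_cases hy : Z t ω ∈ B <;> simp [hy]
    rw [h3, integral_indicator_one ((hZ t).measurable hB)] at h2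
    have h4 : ∫⁻ ω in A, P s t (Z s ω) B ∂μ = ENNReal.ofReal (∫ ω in A, (P s t (Z s ω)).real B ∂μ) := by
      rw [ofReal_integral_eq_lintegral_ofReal]
      · exact lintegral_congr fun ω ↦ (ofReal_measureReal).symm
      · refine Integrable.of_bound (C := 1) ?_ (ae_of_all _ fun ω ↦ ?_)
        · exact ((Measure.measurable_coe hB).comp hk).ennreal_toReal.aestronglyMeasurable
        · rw [Real.norm_eq_abs, abs_of_nonneg measureReal_nonneg]
          exact measureReal_le_one
      · exact ae_of_all _ fun ω ↦ measureReal_nonneg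
    rw [h4, h2, ofReal_measureReal]
  rw [← lintegral_map hg (hZ t).measurable, key, Measure.lintegral_bind hk.aemeasurable
    hg.aemeasurable]

/-- The Markov property of a self-similar process at deterministic times, rescaled so that the
terminal time is `t`. -/
theorem IsMarkovProcess.lintegral_rescaled {hZ : ∀ t, StronglyMeasurable (Z t)}
    (h : IsMarkovProcess Z hZ P μ) (hss : IsSelfSimilar κ Z μ) {ι : Type*} (c w : ι → ℝ) {p q : ℝ}
    (hw : ∀ i, w i ≤ p) (hpq : p ≤ q) {t : ℝ≥0} (ht : 0 < t) {C : Set (ι → ℝ)}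
    (hC : MeasurableSet C) {g : ℝ → ℝ≥0∞} (hg : Measurable g) :
    ∫⁻ ω, C.indicator 1 (fun i ↦ c i * Real.exp (-κ * w i) * Z (Real.exp (w i)).toNNReal ω)
      * g ((t : ℝ) ^ κ * Real.exp (-κ * q) * Z (Real.exp q).toNNReal ω) ∂μ
    = ∫⁻ ω, C.indicator 1 (fun i ↦ c i * Real.exp (-κ * w i) * Z (Real.exp (w i)).toNNReal ω)
      * ∫⁻ y, g y ∂(backwardKernel P t
        (q - p, (t : ℝ) ^ κ * Real.exp (-κ * q) * Z (Real.exp p).toNNReal ω)) ∂μ := by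
  have hm : ∀ t, Measurable (Z t) := fun t ↦ (hZ t).measurable
  have ht' : (0 : ℝ) < t := NNReal.coe_pos.2 ht
  -- With this choice scaling by `exp x` carries `t` to `exp q` and `exp(-(q - p)) t` to `exp p`.
  set x : ℝ := q - Real.log t with hx
  have hself := hss.identDistrib hm (c := (Real.exp x).toNNReal)
    (Real.toNNReal_pos.2 (Real.exp_pos x))
  have hexp : ∀ r, (Real.exp x).toNNReal * (Real.exp (r - x)).toNNReal = (Real.exp r).toNNReal :=
    fun r ↦ by rw [← exp_toNNReal_add, add_sub_cancel]
  have hxt : (Real.exp x).toNNReal * t = (Real.exp q).toNNReal := by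
    rw [← hexp q, hx, sub_sub_cancel, Real.exp_log ht', Real.toNNReal_coe]
  set s : ℝ≥0 := (Real.exp (-|q - p|)).toNNReal * t with hsdef
  have hs : 0 < s := exp_neg_abs_mul_pos ht _
  have hst : s ≤ t := exp_neg_abs_mul_le t _
  have hs' : s = (Real.exp (p - x)).toNNReal := by
    rw [hsdef, abs_of_nonneg (sub_nonneg.2 hpq)]
    conv_lhs => rw [← Real.toNNReal_coe (r := t), ← Real.exp_log ht', ← exp_toNNReal_add]
    rw [hx]
    ring_nf
  -- The prefactor of `Z_{exp q}` cancels against the power of the scaling factor, so `g` is applied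
  -- to `Z t` itself.
  have hone : (t : ℝ) ^ κ * Real.exp (-κ * q) * Real.exp (κ * x) = 1 := by
    rw [Real.rpow_def_of_pos ht', ← Real.exp_add, ← Real.exp_add, hx, ← Real.exp_zero]
    ring_nf
  let Θ : (ℝ≥0 → ℝ) → ι → ℝ := fun z i ↦ c i * Real.exp (-κ * w i) * z (Real.exp (w i - x)).toNNReal
  have hΘ : Measurable Θ := by fun_prop
  let F : (ℝ≥0 → ℝ) → ℝ≥0∞ := fun z ↦
    C.indicator 1 (Θ z) * g ((t : ℝ) ^ κ * Real.exp (-κ * q) * z t)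
  let G : (ℝ≥0 → ℝ) → ℝ≥0∞ := fun z ↦
    C.indicator 1 (Θ z) * ∫⁻ y, g y ∂(P s t ((t : ℝ) ^ κ * Real.exp (-κ * q) * z s))
  have hind : Measurable fun z ↦ C.indicator (1 : (ι → ℝ) → ℝ≥0∞) (Θ z) :=
    (measurable_one.indicator hC).comp hΘ
  have hF : Measurable F := hind.mul (hg.comp (by fun_prop))
  have hG : Measurable G := by
    refine hind.mul ?_
    exact (Measure.measurable_lintegral hg).comp
      ((h.family.measurable_right hs hst).comp (by fun_prop))
  have e1 := (hself.comp hF).lintegral_eq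
  have e2 := (hself.comp hG).lintegral_eq
  simp only [Function.comp_def, F, Θ, hxt, hexp, exp_toNNReal_rpow, ← mul_assoc, hone, one_mul]
    at e1
  simp only [Function.comp_def, G, Θ, hexp, exp_toNNReal_rpow, ← mul_assoc, hone, one_mul] at e2
  rw [hs', hexp] at e2
  rw [e1]
  simp only [backwardKernel, ← hsdef]
  rw [hs', e2]
  -- After rescaling, the observation times `exp(w i - x)` are at most `s`, because `w i ≤ p`.
  have hpre : MeasurableSet[Filtration.natural Z hZ s]
      ((fun ω i ↦ c i * Real.exp (-κ * w i) * Real.exp (κ * x)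
        * Z (Real.exp (w i - x)).toNNReal ω) ⁻¹' C) := by
    refine @measurable_pi_lambda _ _ _ (_) _ _ (fun i ↦ ?_) _ hC
    refine Measurable.const_mul (measurable_natural hZ ?_) _
    rw [hs']
    exact Real.toNNReal_le_toNNReal (Real.exp_le_exp.2 (by linarith [hw i]))
  rw [lintegral_indicator_one_mul ((Filtration.natural Z hZ).le s _ hpre),
    lintegral_indicator_one_mul ((Filtration.natural Z hZ).le s _ hpre), ← hs',
    h.setLIntegral_eq hs hst hpre hg]

end Markov


/-! ### Conditioning on the clock: Markov and martingale identities -/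

section ProductVersion

variable {Ω : Type*} [MeasurableSpace Ω] {μ : Measure Ω} [IsProbabilityMeasure μ] {κ : ℝ}
  {ζ Z : ℝ≥0 → Ω → ℝ} {P : ℝ≥0 → ℝ≥0 → ℝ → Measure ℝ}

/-- The process `X^{(a)}` with the subordinator and `Z` on two factors of a product space. -/
noncomputable def timeChangeProd {Ω : Type*} (κ : ℝ) (ζ Z : ℝ≥0 → Ω → ℝ) (a : ℝ) (t : ℝ≥0)
    (p : Ω × Ω) : ℝ :=
  (t : ℝ) ^ κ * Real.exp (-κ * ζ (a + Real.log t).toNNReal p.1)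
    * Z (Real.exp (ζ (a + Real.log t).toNNReal p.1)).toNNReal p.2

theorem measurable_timeChangeProd {Ω : Type*} [MeasurableSpace Ω] {μ : Measure Ω} {κ : ℝ}
    {ζ Z : ℝ≥0 → Ω → ℝ} (hZ : ∀ t, Measurable (Z t))
    (hr : ∀ ω t, ContinuousWithinAt (fun t ↦ Z t ω) (Set.Ici t) t) (hζ : IsSubordinator ζ μ)
    (a : ℝ) (t : ℝ≥0) : Measurable (timeChangeProd κ ζ Z a t) := by
  have hm := hζ.measurable (a + Real.log t).toNNReal
  refine Measurable.mul (by fun_prop) ?_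
  exact (measurable_of_rightContinuous hZ hr).comp
    (f := fun p : Ω × Ω ↦ (p.2, (Real.exp (ζ (a + Real.log t).toNNReal p.1)).toNNReal))
    (by fun_prop)

/-- Decoupling with zero shift. On the product space Fubini freezes the clock and leaves `Z` at
deterministic times. -/
theorem sameFDD_timeChangeProd (hZ : ∀ t, Measurable (Z t))
    (hr : ∀ ω t, ContinuousWithinAt (fun t ↦ Z t ω) (Set.Ici t) t) (hs : IsSelfSimilar κ Z μ)
    (hζ : IsSubordinator ζ μ) (hind : IndepFun (fun ω t ↦ ζ t ω) (fun ω t ↦ Z t ω) μ) (a : ℝ) :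
    SameFDD {t : ℝ≥0 | Real.exp (-a) ≤ t} (timeChange κ ζ Z a) μ
      (timeChangeProd κ ζ Z a) (μ.prod μ) := by
  have hm := hζ.measurable
  refine SameFDD.of_identDistrib ?_
  have := identDistrib_timeChange_prod
    (fun i : {t : ℝ≥0 | Real.exp (-a) ≤ t} ↦ ((i : ℝ≥0) : ℝ) ^ κ) hZ hr hs
    (W := fun i ↦ ζ (a + Real.log (i : ℝ≥0)).toNNReal) (H := fun _ ↦ 0) (fun _ ↦ hm _)
    measurable_const
    (hind.comp (φ := fun (z : ℝ≥0 → ℝ) (i : {t : ℝ≥0 | Real.exp (-a) ≤ t}) ↦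
      z (a + Real.log (i : ℝ≥0)).toNNReal) (by fun_prop) measurable_id)
  simp only [sub_zero] at this
  exact this

theorem toNNReal_add_log {a : ℝ} {s t : ℝ≥0} (hs : Real.exp (-a) ≤ s) (hst : s ≤ t) :
    (a + Real.log t).toNNReal = (a + Real.log s).toNNReal + (Real.log (t / s)).toNNReal := by
  have hs' : (0 : ℝ) < s := (Real.exp_pos _).trans_le hs
  have ht' : (0 : ℝ) < t := hs'.trans_le (NNReal.coe_le_coe.2 hst)
  rw [← Real.toNNReal_add (log_add_nonneg hs)
    (Real.log_nonneg ((one_le_div hs').2 (NNReal.coe_le_coe.2 hst))), Real.log_div ht'.ne' hs'.ne']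
  ring_nf

theorem toNNReal_add_log_le (a : ℝ) {s t : ℝ≥0} (hs : 0 < s) (hst : s ≤ t) :
    (a + Real.log s).toNNReal ≤ (a + Real.log t).toNNReal :=
  Real.toNNReal_le_toNNReal (add_le_add_right (Real.log_le_log hs hst) a)

/-- The increment of the clock between `s` and `t`, jointly with its past, is distributed as an
independent copy of `ζ_{ln(t/s)}`. -/
theorem IsSubordinator.identDistrib_past_increment (hζ : IsSubordinator ζ μ) {a : ℝ} {s t : ℝ≥0}
    (hs : Real.exp (-a) ≤ s) (hst : s ≤ t) :
    IdentDistrib (fun ω ↦ ((fun u : Set.Iic (a + Real.log s).toNNReal ↦ ζ u ω),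
        ζ (a + Real.log t).toNNReal ω - ζ (a + Real.log s).toNNReal ω))
      (fun p : Ω × Ω ↦ ((fun u : Set.Iic (a + Real.log s).toNNReal ↦ ζ u p.1),
        ζ (Real.log (t / s)).toNNReal p.2)) μ (μ.prod μ) := by
  have hm := hζ.measurable
  have h1 : Measurable fun ω (u : Set.Iic (a + Real.log s).toNNReal) ↦ ζ u ω := by fun_prop
  refine IdentDistrib.prodMk (identDistrib_comp_fst h1).symm ?_
    (indepFun_past_increment hm hζ.indep hζ.zero
      (toNNReal_add_log_le a (pos_of_exp_le hs) hst)) (indepFun_prod h1 (hm _))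
  rw [toNNReal_add_log hs hst]
  exact (hζ.stationary _ _).trans (identDistrib_comp_snd (hm _)).symm

/-- The Markov property of the product version of `X^{(a)}`, with the randomised kernel. -/
theorem lintegral_timeChangeProd {hZ : ∀ t, StronglyMeasurable (Z t)}
    (hr : ∀ ω t, ContinuousWithinAt (fun t ↦ Z t ω) (Set.Ici t) t) (hss : IsSelfSimilar κ Z μ)
    (hZP : IsMarkovProcess Z hZ P μ) (hζ : IsSubordinator ζ μ)
    {a : ℝ} {s t : ℝ≥0} (hs : Real.exp (-a) ≤ s) (hst : s ≤ t) {ι : Type*} {τ : ι → ℝ≥0}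
    (hτ : ∀ i, 0 < τ i) (hτs : ∀ i, τ i ≤ s) {C : Set (ι → ℝ)} (hC : MeasurableSet C)
    {g : ℝ → ℝ≥0∞} (hg : Measurable g) :
    ∫⁻ p, C.indicator 1 (fun i ↦ timeChangeProd κ ζ Z a (τ i) p) * g (timeChangeProd κ ζ Z a t p)
      ∂(μ.prod μ)
    = ∫⁻ p, C.indicator 1 (fun i ↦ timeChangeProd κ ζ Z a (τ i) p)
      * ∫⁻ y, g y ∂(randomisedKernel κ ζ μ P s t (timeChangeProd κ ζ Z a s p)) ∂(μ.prod μ) := by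
  have hm := hζ.measurable
  have hZm : ∀ t, Measurable (Z t) := fun t ↦ (hZ t).measurable
  have hZj := measurable_of_rightContinuous hZm hr
  have hs0 : 0 < s := pos_of_exp_le hs
  have ht0 : 0 < t := hs0.trans_le hst
  have hs0' : (0 : ℝ) < s := NNReal.coe_pos.2 hs0
  have ht0' : (0 : ℝ) < t := NNReal.coe_pos.2 ht0
  set m : ℝ≥0 := (a + Real.log s).toNNReal with hmdef
  set L : ℝ≥0 := (Real.log (t / s)).toNNReal with hL
  let e : ι → Set.Iic m := fun i ↦ ⟨_, toNNReal_add_log_le a (hτ i) (hτs i)⟩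
  let e₀ : Set.Iic m := ⟨m, Set.mem_Iic.2 le_rfl⟩
  let past : Ω → Set.Iic m → ℝ := fun ω u ↦ ζ u ω
  let ξ : Ω → ℝ := fun ω ↦ ζ (a + Real.log t).toNNReal ω - ζ m ω
  let V : (Set.Iic m → ℝ) × Ω → ι → ℝ := fun x i ↦
    (τ i : ℝ) ^ κ * Real.exp (-κ * x.1 (e i)) * Z (Real.exp (x.1 (e i))).toNNReal x.2
  have hZc : ∀ j : Set.Iic m, Measurable fun x : (Set.Iic m → ℝ) × Ω ↦
      Z (Real.exp (x.1 j)).toNNReal x.2 := fun j ↦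
    hZj.comp (f := fun x : (Set.Iic m → ℝ) × Ω ↦ (x.2, (Real.exp (x.1 j)).toNNReal)) (by fun_prop)
  have hV : Measurable V := measurable_pi_lambda _ fun i ↦ Measurable.mul (by fun_prop) (hZc _)
  -- Both sides are integrals of this function of the clock's past, an increment and `Z`: the left
  -- with the true increment `ξ`, the right with an independent copy of `ζ L`.
  let Ψ : ((Set.Iic m → ℝ) × ℝ) × Ω → ℝ≥0∞ := fun x ↦ C.indicator 1 (V (x.1.1, x.2)) *
    ∫⁻ y, g y ∂(backwardKernel P t (x.1.2, (t : ℝ) ^ κ * Real.exp (-κ * (x.1.1 e₀ + x.1.2))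
      * Z (Real.exp (x.1.1 e₀)).toNNReal x.2))
  have hΨ : Measurable Ψ := by
    refine Measurable.mul ((measurable_one.indicator hC).comp (hV.comp (by fun_prop))) ?_
    refine (Measure.measurable_lintegral hg).comp
      ((hZP.family.measurable_backwardKernel ht0).comp (Measurable.prodMk (by fun_prop) ?_))
    refine Measurable.mul (by fun_prop) ?_
    exact (hZc e₀).comp (f := fun x : ((Set.Iic m → ℝ) × ℝ) × Ω ↦ (x.1.1, x.2)) (by fun_prop)
  have hΦ : Measurable fun y ↦ ∫⁻ ω, Ψ (y, ω) ∂μ := hΨ.lintegral_prod_right'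
  have hpast : Measurable past := by fun_prop
  have hξ : Measurable ξ := by fun_prop
  have htcp : ∀ u, Measurable (timeChangeProd κ ζ Z a u) := measurable_timeChangeProd hZm hr hζ a
  have hLHS : Measurable fun p ↦ C.indicator (1 : (ι → ℝ) → ℝ≥0∞)
      (fun i ↦ timeChangeProd κ ζ Z a (τ i) p) * g (timeChangeProd κ ζ Z a t p) :=
    ((measurable_one.indicator hC).comp (measurable_pi_lambda _ fun i ↦ htcp _)).mul
      (hg.comp (htcp _))
  -- the left-hand side
  have h1 : ∫⁻ p, C.indicator 1 (fun i ↦ timeChangeProd κ ζ Z a (τ i) p)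
      * g (timeChangeProd κ ζ Z a t p) ∂(μ.prod μ)
      = ∫⁻ ω₁, ∫⁻ ω₂, Ψ ((past ω₁, ξ ω₁), ω₂) ∂μ ∂μ := by
    rw [lintegral_prod _ hLHS.aemeasurable]
    refine lintegral_congr fun ω₁ ↦ ?_
    have := hZP.lintegral_rescaled hss (fun i ↦ (τ i : ℝ) ^ κ)
      (fun i ↦ ζ (a + Real.log (τ i)).toNNReal ω₁) (p := ζ m ω₁)
      (q := ζ (a + Real.log t).toNNReal ω₁)
      (fun i ↦ hζ.mono ω₁ (toNNReal_add_log_le a (hτ i) (hτs i)))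
      (hζ.mono ω₁ (toNNReal_add_log_le a hs0 hst)) ht0 hC hg
    refine this.trans (lintegral_congr fun ω₂ ↦ ?_)
    simp only [Ψ, V, past, ξ, e, e₀, add_sub_cancel]
  -- the right-hand side
  have h2 : ∫⁻ p, C.indicator 1 (fun i ↦ timeChangeProd κ ζ Z a (τ i) p)
      * ∫⁻ y, g y ∂(randomisedKernel κ ζ μ P s t (timeChangeProd κ ζ Z a s p)) ∂(μ.prod μ)
      = ∫⁻ p, ∫⁻ ω₃, Ψ ((past p.1, ζ L ω₃), p.2) ∂μ ∂(μ.prod μ) := by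
    refine lintegral_congr fun p ↦ ?_
    rw [lintegral_randomisedKernel hZP.family hζ hs0 hst _ hg, ← lintegral_const_mul]
    · refine lintegral_congr fun ω₃ ↦ ?_
      -- The initial state prescribed by the randomised kernel is the rescaled value of `Z_{exp p}`;
      -- the factor `s ^ κ` cancels.
      have : (t : ℝ) ^ κ * Real.exp (-κ * (ζ m p.1 + ζ L ω₃)) * Z (Real.exp (ζ m p.1)).toNNReal p.2
          = (t / s : ℝ) ^ κ * Real.exp (-κ * ζ L ω₃) * timeChangeProd κ ζ Z a s p := by
        have h3 : (s : ℝ) ^ κ ≠ 0 := (Real.rpow_pos_of_pos hs0' κ).ne'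
        rw [timeChangeProd, ← hmdef, Real.div_rpow ht0'.le hs0'.le, mul_add, Real.exp_add]
        field_simp
      simp only [Ψ, V, past, e, e₀, this]
      rfl
    · exact (Measure.measurable_lintegral hg).comp
        ((hZP.family.measurable_backwardKernel ht0).comp (by fun_prop))
  have hΨ' : Measurable fun x : (Ω × Ω) × Ω ↦ Ψ ((past x.1.1, ζ L x.2), x.1.2) :=
    hΨ.comp (by fun_prop)
  rw [h1, h2, lintegral_prod _ hΨ'.lintegral_prod_right'.aemeasurable]
  -- The true increment is exchanged for the independent copy, jointly with the past of the clock.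
  refine (((hζ.identDistrib_past_increment hs hst).comp hΦ).lintegral_eq).trans ?_
  rw [lintegral_prod]
  · refine lintegral_congr fun ω₁ ↦ ?_
    exact lintegral_lintegral_swap (hΨ.comp
      (f := fun x : Ω × Ω ↦ ((past ω₁, ζ L x.1), x.2)) (by fun_prop)).aemeasurable
  · exact (hΦ.comp (f := fun p : Ω × Ω ↦ (past p.1, ζ L p.2)) (by fun_prop)).aemeasurable

/-- The martingale property of the product version of `X^{(a)}`. -/
theorem integral_timeChangeProd {hZ : ∀ t, StronglyMeasurable (Z t)}
    (hr : ∀ ω t, ContinuousWithinAt (fun t ↦ Z t ω) (Set.Ici t) t)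
    (hZmart : Martingale Z (Filtration.natural Z hZ) μ) (hζ : IsSubordinator ζ μ)
    {a : ℝ} {s t : ℝ≥0} (hs : Real.exp (-a) ≤ s) (hst : s ≤ t)
    (hexp : ∫ ω, Real.exp (-κ * ζ (Real.log (t / s)).toNNReal ω) ∂μ = ((s : ℝ) / t) ^ κ)
    (his : Integrable (timeChangeProd κ ζ Z a s) (μ.prod μ))
    (hit : Integrable (timeChangeProd κ ζ Z a t) (μ.prod μ)) {ι : Type*} {τ : ι → ℝ≥0}
    (hτ : ∀ i, 0 < τ i) (hτs : ∀ i, τ i ≤ s) {C : Set (ι → ℝ)} (hC : MeasurableSet C) :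
    ∫ p, C.indicator 1 (fun i ↦ timeChangeProd κ ζ Z a (τ i) p) * timeChangeProd κ ζ Z a t p
      ∂(μ.prod μ)
    = ∫ p, C.indicator 1 (fun i ↦ timeChangeProd κ ζ Z a (τ i) p) * timeChangeProd κ ζ Z a s p
      ∂(μ.prod μ) := by
  have hm := hζ.measurable
  have hZm : ∀ t, Measurable (Z t) := fun t ↦ (hZ t).measurable
  have hZj := measurable_of_rightContinuous hZm hr
  have hs0 : 0 < s := pos_of_exp_le hs
  have ht0 : 0 < t := hs0.trans_le hst
  have hs0' : (0 : ℝ) < s := NNReal.coe_pos.2 hs0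
  have ht0' : (0 : ℝ) < t := NNReal.coe_pos.2 ht0
  set m : ℝ≥0 := (a + Real.log s).toNNReal with hmdef
  set L : ℝ≥0 := (Real.log (t / s)).toNNReal with hL
  let e : ι → Set.Iic m := fun i ↦ ⟨_, toNNReal_add_log_le a (hτ i) (hτs i)⟩
  let e₀ : Set.Iic m := ⟨m, Set.mem_Iic.2 le_rfl⟩
  let past : Ω → Set.Iic m → ℝ := fun ω u ↦ ζ u ω
  let ξ : Ω → ℝ := fun ω ↦ ζ (a + Real.log t).toNNReal ω - ζ m ω
  let V : (Set.Iic m → ℝ) × Ω → ι → ℝ := fun x i ↦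
    (τ i : ℝ) ^ κ * Real.exp (-κ * x.1 (e i)) * Z (Real.exp (x.1 (e i))).toNNReal x.2
  have hZc : ∀ j : Set.Iic m, Measurable fun x : (Set.Iic m → ℝ) × Ω ↦
      Z (Real.exp (x.1 j)).toNNReal x.2 := fun j ↦
    hZj.comp (f := fun x : (Set.Iic m → ℝ) × Ω ↦ (x.2, (Real.exp (x.1 j)).toNNReal)) (by fun_prop)
  have hV : Measurable V := measurable_pi_lambda _ fun i ↦ Measurable.mul (by fun_prop) (hZc _)
  let Ψ : (Set.Iic m → ℝ) × Ω → ℝ := fun x ↦ C.indicator 1 (V x) *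
    ((s : ℝ) ^ κ * Real.exp (-κ * x.1 e₀) * Z (Real.exp (x.1 e₀)).toNNReal x.2)
  have hΨ : Measurable Ψ := ((measurable_one.indicator hC).comp hV).mul
    (Measurable.mul (by fun_prop) (hZc e₀))
  have hΦ : Measurable fun z ↦ ∫ ω, Ψ (z, ω) ∂μ :=
    hΨ.stronglyMeasurable.integral_prod_right'.measurable
  have hpast : Measurable past := by fun_prop
  have hξ : Measurable ξ := by fun_prop
  have htcp : ∀ u, Measurable (timeChangeProd κ ζ Z a u) := measurable_timeChangeProd hZm hr hζ a
  have hindm : Measurable fun p ↦ C.indicator (1 : (ι → ℝ) → ℝ)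
      (fun i ↦ timeChangeProd κ ζ Z a (τ i) p) :=
    (measurable_one.indicator hC).comp (measurable_pi_lambda _ fun i ↦ htcp _)
  have hindb : ∀ x, ‖C.indicator (1 : (ι → ℝ) → ℝ) x‖ ≤ 1 := fun x ↦ by
    by_cases hx : x ∈ C <;> simp [hx]
  have hint : ∀ {f : Ω × Ω → ℝ}, Integrable f (μ.prod μ) → Integrable (fun p ↦
      C.indicator (1 : (ι → ℝ) → ℝ) (fun i ↦ timeChangeProd κ ζ Z a (τ i) p) * f p) (μ.prod μ) :=
    fun hf ↦ hf.bdd_mul hindm.aestronglyMeasurable (ae_of_all _ fun p ↦ hindb _)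
  rw [integral_prod _ (hint hit), integral_prod _ (hint his)]
  -- the inner integral, by the martingale property of `Z`
  have h1 : ∀ ω₁, ∫ ω₂, C.indicator 1 (fun i ↦ timeChangeProd κ ζ Z a (τ i) (ω₁, ω₂))
      * timeChangeProd κ ζ Z a t (ω₁, ω₂) ∂μ
      = ((t : ℝ) / s) ^ κ * (Real.exp (-κ * ξ ω₁) * ∫ ω₂, Ψ (past ω₁, ω₂) ∂μ) := by
    intro ω₁
    set p := ζ m ω₁ with hp
    set q := ζ (a + Real.log t).toNNReal ω₁ with hq
    have hpq : p ≤ q := hζ.mono ω₁ (toNNReal_add_log_le a hs0 hst)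
    have hA : MeasurableSet[Filtration.natural Z hZ (Real.exp p).toNNReal]
        ((fun ω₂ ↦ V (past ω₁, ω₂)) ⁻¹' C) := by
      refine @measurable_pi_lambda _ _ _ (_) _ _ (fun i ↦ ?_) _ hC
      have hle : (Real.exp (past ω₁ (e i))).toNNReal ≤ (Real.exp p).toNNReal :=
        Real.toNNReal_le_toNNReal (Real.exp_le_exp.2
          (hζ.mono ω₁ (toNNReal_add_log_le a (hτ i) (hτs i))))
      exact (measurable_natural hZ hle).const_mul
        ((τ i : ℝ) ^ κ * Real.exp (-κ * past ω₁ (e i)))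
    have hA' := (Filtration.natural Z hZ).le _ _ hA
    have hset := hZmart.setIntegral_eq (Real.toNNReal_le_toNNReal (Real.exp_le_exp.2 hpq)) hA
    have hconv : ∀ (c : ℝ) (f : Ω → ℝ), ∫ ω₂, C.indicator 1 (V (past ω₁, ω₂)) * (c * f ω₂) ∂μ
        = c * ∫ ω₂ in (fun ω₂ ↦ V (past ω₁, ω₂)) ⁻¹' C, f ω₂ ∂μ := fun c f ↦ by
      rw [← integral_indicator hA', ← integral_const_mul]
      refine integral_congr_ae (ae_of_all _ fun ω₂ ↦ ?_)
      by_cases h : V (past ω₁, ω₂) ∈ C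
      · simp [Set.indicator, h]
      · simp [Set.indicator, h]
    have e1 := hconv ((t : ℝ) ^ κ * Real.exp (-κ * q)) (fun ω₂ ↦ Z (Real.exp q).toNNReal ω₂)
    have e2 := hconv ((s : ℝ) ^ κ * Real.exp (-κ * p)) (fun ω₂ ↦ Z (Real.exp p).toNNReal ω₂)
    have h3 : (s : ℝ) ^ κ ≠ 0 := (Real.rpow_pos_of_pos hs0' κ).ne'
    -- After the martingale property replaces `Z_{exp q}` by `Z_{exp p}`, the prefactor at `t`
    -- splits into the prefactor at `s` and a factor depending only on the increment of the clock.
    have h4 : (t : ℝ) ^ κ * Real.exp (-κ * q)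
        = ((t : ℝ) / s) ^ κ * (Real.exp (-κ * ξ ω₁) * ((s : ℝ) ^ κ * Real.exp (-κ * p))) := by
      have : -κ * q = -κ * ξ ω₁ + -κ * p := by simp only [ξ, ← hp, ← hq]; ring
      rw [this, Real.exp_add, Real.div_rpow ht0'.le hs0'.le]
      field_simp
    refine e1.trans ?_
    rw [← hset, h4, mul_assoc, mul_assoc, ← e2]
  have h2 : ∫ ω₁, ∫ ω₂, C.indicator 1 (fun i ↦ timeChangeProd κ ζ Z a (τ i) (ω₁, ω₂))
      * timeChangeProd κ ζ Z a s (ω₁, ω₂) ∂μ ∂μ = ∫ ω₁, ∫ ω₂, Ψ (past ω₁, ω₂) ∂μ ∂μ := rfl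
  -- The remaining integral depends only on the past of the clock, so the expectation factorises,
  -- and the mean `(s/t)^κ` cancels `(t/s)^κ`.
  have hind : IndepFun (fun ω₁ ↦ Real.exp (-κ * ξ ω₁)) (fun ω₁ ↦ ∫ ω₂, Ψ (past ω₁, ω₂) ∂μ) μ :=
    (indepFun_past_increment hm hζ.indep hζ.zero
      (toNNReal_add_log_le a hs0 hst)).symm.comp (φ := fun x ↦ Real.exp (-κ * x)) (by fun_prop) hΦ
  have hξexp : ∫ ω₁, Real.exp (-κ * ξ ω₁) ∂μ = ((s : ℝ) / t) ^ κ := by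
    rw [← hexp]
    have := (hζ.stationary m L).comp (u := fun x ↦ Real.exp (-κ * x)) (by fun_prop)
    rw [hmdef, hL, ← toNNReal_add_log hs hst] at this
    exact this.integral_eq
  simp_rw [h1]
  rw [h2, integral_const_mul, hind.integral_fun_mul_eq_mul_integral
    (Measurable.aestronglyMeasurable (by fun_prop)) (hΦ.comp hpast).aestronglyMeasurable, hξexp,
    ← mul_assoc, ← Real.mul_rpow (by positivity) (by positivity)]
  rw [div_mul_div_cancel₀ hs0'.ne', div_self ht0'.ne', Real.one_rpow, one_mul]

end ProductVersion


/-! ### From cylinders to the natural filtration -/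

section Cylinders

variable {Ω : Type*} [MeasurableSpace Ω] {ν : Measure Ω} {X : ℝ≥0 → Ω → ℝ}

/-- An integrable function whose integral vanishes on all finite-dimensional cylinders of the past
has vanishing integral on all sets of the natural filtration. -/
theorem setIntegral_natural_eq_zero (hX : ∀ t, StronglyMeasurable (X t)) {f : Ω → ℝ}
    (hf : Integrable f ν) {s : ℝ≥0}
    (h : ∀ (J : Finset (Set.Iic s)) (C : Set (J → ℝ)), MeasurableSet C →
      ∫ ω in (fun ω (j : J) ↦ X j ω) ⁻¹' C, f ω ∂ν = 0) {A : Set Ω}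
    (hA : MeasurableSet[Filtration.natural X hX s] A) : ∫ ω in A, f ω ∂ν = 0 := by
  have hle := (Filtration.natural X hX).le s
  have huniv : ∫ ω, f ω ∂ν = 0 := by
    have := h ∅ Set.univ MeasurableSet.univ
    rwa [Set.preimage_univ, setIntegral_univ] at this
  -- Preimages of square cylinders form a π-system generating the past, so a Dynkin induction
  -- applies; the integral over the whole space, needed for complements, is the cylinder with no
  -- coordinates.
  let πX := {A : Set Ω | ∃ T ∈ squareCylinders (fun _ : Set.Iic s ↦ {B : Set ℝ | MeasurableSet B}),
    (fun ω (i : Set.Iic s) ↦ X i ω) ⁻¹' T = A}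
  have hpi : IsPiSystem πX :=
    IsPiSystem.comap (isPiSystem_squareCylinders (fun _ ↦ MeasurableSpace.isPiSystem_measurableSet)
      (by simp)) _
  have hgen : Filtration.natural X hX s = MeasurableSpace.generateFrom πX := by
    rw [Filtration.natural_eq_comap, generateFrom_squareCylinders.symm,
      MeasurableSpace.comap_generateFrom]
    rfl
  induction A, hA using MeasurableSpace.induction_on_inter hgen hpi with
  | empty => simp
  | basic A hA =>
    obtain ⟨-, ⟨I, S, hS, rfl⟩, rfl⟩ := hA
    simp only [Set.mem_pi, Set.mem_univ, Set.mem_ofPred_eq, forall_const] at hS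
    have : (fun ω (i : Set.Iic s) ↦ X i ω) ⁻¹' Set.pi I S =
        (fun ω (i : I) ↦ X i ω) ⁻¹' Set.pi Set.univ (fun i ↦ S i) := by
      ext; simp
    rw [this]
    exact h I _ (MeasurableSet.univ_pi fun i ↦ hS i)
  | compl A hA ih => rw [setIntegral_compl (hle _ hA) hf, ih, huniv, sub_zero]
  | iUnion A hd hA ih =>
    rw [integral_iUnion (fun i ↦ hle _ (hA i)) hd hf.integrableOn]
    simp [ih]

theorem measurableSet_cylinder (hX : ∀ t, StronglyMeasurable (X t)) {s : ℝ≥0}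
    (J : Finset (Set.Iic s)) {C : Set (J → ℝ)} (hC : MeasurableSet C) :
    MeasurableSet ((fun ω (j : J) ↦ X j ω) ⁻¹' C) :=
  (measurable_pi_lambda _ fun j : J ↦ (hX j).measurable) hC

/-- The conditional expectation given the past, from the law of `X_t` on finite-dimensional
cylinders of the past. -/
theorem condExp_eq_integral_of_cylinder [IsProbabilityMeasure ν]
    (hX : ∀ t, StronglyMeasurable (X t)) {s t : ℝ≥0} (k : Kernel ℝ ℝ) [IsMarkovKernel k]
    (h : ∀ (J : Finset (Set.Iic s)) (C : Set (J → ℝ)), MeasurableSet C →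
      ∀ g : ℝ → ℝ≥0∞, Measurable g → ∫⁻ ω in (fun ω (j : J) ↦ X j ω) ⁻¹' C, g (X t ω) ∂ν
        = ∫⁻ ω in (fun ω (j : J) ↦ X j ω) ⁻¹' C, ∫⁻ y, g y ∂(k (X s ω)) ∂ν)
    {g : ℝ → ℝ} (hg : Measurable g) {K : ℝ} (hK : ∀ y, |g y| ≤ K) :
    ν[fun ω ↦ g (X t ω) | Filtration.natural X hX s] =ᵐ[ν] fun ω ↦ ∫ y, g y ∂(k (X s ω)) := by
  have hle := (Filtration.natural X hX).le s
  have hm : StronglyMeasurable fun x ↦ ∫ y, g y ∂(k x) := hg.stronglyMeasurable.integral_kernel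
  have hb : ∀ x, ‖∫ y, g y ∂(k x)‖ ≤ K := fun x ↦ by
    refine (norm_integral_le_of_norm_le_const (ae_of_all _ hK)).trans ?_
    simp
  have hi1 : Integrable (fun ω ↦ g (X t ω)) ν :=
    Integrable.of_bound (hg.comp (hX t).measurable).aestronglyMeasurable K
      (ae_of_all _ fun ω ↦ hK _)
  have hi2 : Integrable (fun ω ↦ ∫ y, g y ∂(k (X s ω))) ν :=
    Integrable.of_bound (hm.measurable.comp (hX s).measurable).aestronglyMeasurable K
      (ae_of_all _ fun ω ↦ hb _)
  refine (ae_eq_condExp_of_forall_setIntegral_eq hle hi1 (fun A _ _ ↦ hi2.integrableOn)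
    (fun A hA _ ↦ ?_) ?_).symm
  · rw [← sub_eq_zero, ← integral_sub hi2.integrableOn hi1.integrableOn]
    refine setIntegral_natural_eq_zero hX (hi2.sub hi1) (fun J C hC ↦ ?_) hA
    set D := (fun ω (j : J) ↦ X j ω) ⁻¹' C
    -- Stating the hypothesis as an equality of measures lets it be applied to the signed function
    -- `g`.
    have hlaw : (ν.restrict D).map (X t)
        = (k ∘ₖ Kernel.const Unit ((ν.restrict D).map (X s))) () := by
      rw [Kernel.comp_apply, Kernel.const_apply]
      ext B hB
      have := h J C hC (B.indicator 1) (measurable_one.indicator hB)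
      simp only [lintegral_indicator_one hB] at this
      rw [Measure.bind_apply hB k.aemeasurable, lintegral_map (k.measurable_coe hB)
        (hX s).measurable, ← this, ← lintegral_indicator_one hB,
        lintegral_map (measurable_one.indicator hB) (hX t).measurable]
    have e1 : ∫ ω in D, g (X t ω) ∂ν = ∫ ω in D, ∫ y, g y ∂(k (X s ω)) ∂ν := by
      rw [← integral_map (hX t).measurable.aemeasurable hg.aestronglyMeasurable, hlaw,
        Kernel.integral_comp, Kernel.const_apply, integral_map (hX s).measurable.aemeasurable hm.aestronglyMeasurable]
      exact Integrable.of_bound hg.aestronglyMeasurable K (ae_of_all _ hK)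
    simp only [Pi.sub_apply]
    rw [integral_sub hi2.integrableOn hi1.integrableOn, e1, sub_self]
  · exact (hm.comp_measurable (measurable_natural hX le_rfl)).aestronglyMeasurable

/-- The law of a process vanishing at `0` on cylinders, jointly with its values at two positive
times, in terms of processes with the same finite-dimensional distributions away from `0`. -/
theorem exists_identDistrib_cylinder {Ω' : Type*} [MeasurableSpace Ω'] {ρ : Measure Ω'}
    {Y : ℝ → ℝ≥0 → Ω' → ℝ} (hX0 : ∀ ω, X 0 ω = 0)
    (h : ∀ a : ℝ, SameFDD {t : ℝ≥0 | Real.exp (-a) ≤ t} X ν (Y a) ρ) {s t : ℝ≥0} (hs : 0 < s)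
    (ht : 0 < t) (J : Finset (Set.Iic s)) {C : Set (J → ℝ)} (hC : MeasurableSet C) :
    ∃ a : ℝ, Real.exp (-a) ≤ s ∧ Real.exp (-a) ≤ t ∧
      ∃ K : Finset ℝ≥0, (∀ i : K, (0 : ℝ≥0) < i) ∧ (∀ i : K, (i : ℝ≥0) ≤ s) ∧
        ∃ C' : Set (K → ℝ), MeasurableSet C' ∧
          (fun ω (j : J) ↦ X j ω) ⁻¹' C = (fun ω (i : K) ↦ X i ω) ⁻¹' C' ∧
          IdentDistrib (fun ω ↦ ((fun i : K ↦ X i ω), X s ω, X t ω))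
            (fun ω ↦ ((fun i : K ↦ Y a i ω), Y a s ω, Y a t ω)) ν ρ := by
  classical
  let K : Finset ℝ≥0 := (J.image Subtype.val).filter (0 < ·)
  have hK : ∀ i ∈ K, 0 < i ∧ i ≤ s := fun i hi ↦ by
    obtain ⟨h1, h2⟩ := Finset.mem_filter.1 hi
    obtain ⟨j, -, rfl⟩ := Finset.mem_image.1 h1
    exact ⟨h2, j.2⟩
  let I : Finset ℝ≥0 := insert s (insert t K)
  have hI : ∀ i ∈ I, 0 < i := fun i hi ↦ by
    rcases Finset.mem_insert.1 hi with rfl | hi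
    · exact hs
    rcases Finset.mem_insert.1 hi with rfl | hi
    · exact ht
    · exact (hK i hi).1
  have hsI : s ∈ I := Finset.mem_insert_self _ _
  have htI : t ∈ I := Finset.mem_insert_of_mem (Finset.mem_insert_self _ _)
  have hKI : ∀ i ∈ K, i ∈ I := fun i hi ↦
    Finset.mem_insert_of_mem (Finset.mem_insert_of_mem hi)
  obtain ⟨a, ha⟩ := exists_exp_neg_le I
  -- Time `0` is removed from the cylinder, since the processes `Y a` are controlled only away from
  -- it; `u` restores that coordinate by its value `0`.
  let u : (K → ℝ) → J → ℝ := fun x j ↦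
    if hj : ((j : Set.Iic s) : ℝ≥0) ∈ K then x ⟨_, hj⟩ else 0
  have hu : Measurable u := by
    refine measurable_pi_lambda _ fun j ↦ ?_
    simp only [u]
    split_ifs
    · exact measurable_pi_apply _
    · exact measurable_const
  refine ⟨a, ha s hsI hs, ha t htI ht, K, fun i ↦ (hK i i.2).1, fun i ↦ (hK i i.2).2, u ⁻¹' C,
    hu hC, ?_, ?_⟩
  · rw [← Set.preimage_comp]
    congr 1
    ext ω j
    simp only [Function.comp, u]
    split_ifs with hj
    · rfl
    · have : ((j : Set.Iic s) : ℝ≥0) = 0 := by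
        by_contra hne
        exact hj (Finset.mem_filter.2 ⟨Finset.mem_image_of_mem _ j.2, pos_iff_ne_zero.2 hne⟩)
      rw [this, hX0]
  · exact (h a I fun i hi ↦ ha i hi (hI i hi)).comp
      (u := fun x : I → ℝ ↦ ((fun i : K ↦ x ⟨i, hKI i i.2⟩), x ⟨s, hsI⟩, x ⟨t, htI⟩)) (by fun_prop)

end Cylinders

/-! ### Behaviour at time `0` and one-dimensional marginals -/

section StartingPoint

variable {Ω : Type*} [MeasurableSpace Ω] {μ : Measure Ω} [IsProbabilityMeasure μ] {κ : ℝ}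
  {Z : ℝ≥0 → Ω → ℝ} {P : ℝ≥0 → ℝ≥0 → ℝ → Measure ℝ}

/-- A self-similar process with positive exponent starts at `0`. -/
theorem IsSelfSimilar.zero_ae_eq (hκ : 0 < κ) (hZ : ∀ t, Measurable (Z t))
    (h : IsSelfSimilar κ Z μ) : ∀ᵐ ω ∂μ, Z 0 ω = 0 := by
  have hb : ∀ x : ℝ, ‖Real.exp (-|x|)‖ ≤ 1 := fun x ↦ by
    rw [Real.norm_eq_abs, Real.abs_exp]
    exact Real.exp_le_one_iff.2 (by simp)
  -- Self-similarity at time `0` says that `Z 0` and `c ^ κ * Z 0` have the same law. Letting `c =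
  -- 1/(n+1)` tend to zero forces `E exp(-|Z 0|) = 1`.
  have h1 : ∀ n : ℕ, ∫ ω, Real.exp (-|(1 / ((n : ℝ) + 1)) ^ κ * Z 0 ω|) ∂μ
      = ∫ ω, Real.exp (-|Z 0 ω|) ∂μ := fun n ↦ by
    have := (h.identDistrib hZ (c := 1 / ((n : ℝ≥0) + 1)) (by positivity)).comp
      (u := fun z ↦ Real.exp (-|z 0|)) (by fun_prop)
    simpa [Function.comp_def] using this.integral_eq.symm
  have h2 : Tendsto (fun n : ℕ ↦ ∫ ω, Real.exp (-|(1 / ((n : ℝ) + 1)) ^ κ * Z 0 ω|) ∂μ) atTop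
      (𝓝 (∫ ω, 1 ∂μ)) := by
    refine tendsto_integral_of_dominated_convergence (fun _ ↦ 1) (fun n ↦ ?_)
      (integrable_const 1) (fun n ↦ ae_of_all _ fun ω ↦ hb _) (ae_of_all _ fun ω ↦ ?_)
    · have := hZ 0
      exact Measurable.aestronglyMeasurable (by fun_prop)
    · have h3 : Tendsto (fun n : ℕ ↦ (1 / ((n : ℝ) + 1)) ^ κ) atTop (𝓝 0) := by
        have := (tendsto_one_div_add_atTop_nhds_zero_nat (𝕜 := ℝ)).rpow_const (Or.inr hκ.le)
          (p := κ)
        rwa [Real.zero_rpow hκ.ne'] at this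
      have := (h3.mul_const (Z 0 ω)).abs.neg.rexp
      simpa using this
  simp_rw [h1] at h2
  have h3 := tendsto_nhds_unique tendsto_const_nhds h2
  have hint : Integrable (fun ω ↦ Real.exp (-|Z 0 ω|)) μ :=
    Integrable.of_bound (Measurable.aestronglyMeasurable (by have := hZ 0; fun_prop)) 1
      (ae_of_all _ fun ω ↦ hb _)
  have h4 : ∫ ω, (1 - Real.exp (-|Z 0 ω|)) ∂μ = 0 := by
    rw [integral_sub (integrable_const _) hint, h3, sub_self]
  have h5 := (integral_eq_zero_iff_of_nonneg (fun ω ↦ sub_nonneg.2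
    ((le_abs_self _).trans (hb (Z 0 ω)))) ((integrable_const 1).sub hint)).1 h4
  filter_upwards [h5] with ω hω
  have : Real.exp (-|Z 0 ω|) = 1 := by
    simp only [Pi.zero_apply] at hω
    linarith
  simpa using this

/-- The one-dimensional marginals of a Markov process starting at `0`. -/
theorem IsMarkovProcess.map_eq {hZ : ∀ t, StronglyMeasurable (Z t)}
    (h : IsMarkovProcess Z hZ P μ) (h0 : ∀ᵐ ω ∂μ, Z 0 ω = 0) (t : ℝ≥0) :
    μ.map (Z t) = P 0 t 0 := by
  have := h.family.prob 0 t 0 zero_le (Or.inr rfl)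
  ext B hB
  have h1 := h.markov 0 t zero_le (B.indicator 1) (measurable_one.indicator hB)
    ⟨1, fun y ↦ by by_cases hy : y ∈ B <;> simp [hy]⟩
  have h2 := integral_condExp (μ := μ) ((Filtration.natural Z hZ).le 0)
    (f := fun ω ↦ B.indicator (1 : ℝ → ℝ) (Z t ω))
  have h4 : ∫ ω, ∫ y, B.indicator (1 : ℝ → ℝ) y ∂(P 0 t (Z 0 ω)) ∂μ = (P 0 t 0).real B := by
    rw [integral_congr_ae (h0.mono fun ω hω ↦ by simp only [hω]; rfl)]
    simp [integral_indicator_one hB]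
  have h3 : (fun ω ↦ B.indicator (1 : ℝ → ℝ) (Z t ω)) = (Z t ⁻¹' B).indicator 1 := by
    ext ω
    by_cases hy : Z t ω ∈ B <;> simp [hy]
  rw [integral_congr_ae h1, h4, h3, integral_indicator_one ((hZ t).measurable hB)] at h2
  rw [Measure.map_apply (hZ t).measurable hB, ← ofReal_measureReal, ← h2, ofReal_measureReal]

end StartingPoint


/-! ### The Markov property of the extended process -/

section Markov

variable {Ω : Type*} [MeasurableSpace Ω] {μ : Measure Ω} [IsProbabilityMeasure μ] {κ : ℝ}
  {ζ Z : ℝ≥0 → Ω → ℝ} {P : ℝ≥0 → ℝ≥0 → ℝ → Measure ℝ}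

/-- Measurability in `(s, x)` rests on the joint measurability of the right-continuous process `ζ`,
because the random time change is evaluated at the variable time `ln(t/s)`. -/
theorem isMarkovFamily_randomisedKernel (hP : IsMarkovFamily P) (hζ : IsSubordinator ζ μ) :
    IsMarkovFamily (randomisedKernel κ ζ μ P) where
  prob s t x hst hx := by
    rcases eq_or_ne s 0 with rfl | hs
    · rw [randomisedKernel, if_pos rfl]
      exact hP.prob 0 t x hst hx
    · have hs : 0 < s := pos_iff_ne_zero.2 hs
      refine ⟨?_⟩
      rw [← lintegral_one, lintegral_randomisedKernel hP hζ hs hst x measurable_const]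
      have := hP.isProbabilityMeasure_backwardKernel (hs.trans_le hst)
      simp
  measurable t := by
    rcases eq_or_ne t 0 with rfl | ht
    · have : IsEmpty {p : ℝ≥0 × ℝ // 0 < p.1 ∧ p.1 ≤ 0} :=
        ⟨fun p ↦ absurd (p.2.1.trans_le p.2.2) (lt_irrefl _)⟩
      exact measurable_of_empty _
    have ht : 0 < t := pos_iff_ne_zero.2 ht
    refine Measure.measurable_of_measurable_coe _ fun B hB ↦ ?_
    have hζj := measurable_of_rightContinuous hζ.measurable fun ω t ↦ (hζ.cadlag ω t).1
    have hζc : Measurable fun q : {p : ℝ≥0 × ℝ // 0 < p.1 ∧ p.1 ≤ t} × Ω ↦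
        ζ (Real.log (t / q.1.1.1)).toNNReal q.2 :=
      hζj.comp (f := fun q : {p : ℝ≥0 × ℝ // 0 < p.1 ∧ p.1 ≤ t} × Ω ↦
        (q.2, (Real.log (t / q.1.1.1)).toNNReal)) (by fun_prop)
    have hm : Measurable fun q : {p : ℝ≥0 × ℝ // 0 < p.1 ∧ p.1 ≤ t} × Ω ↦
        backwardKernel P t (ζ (Real.log (t / q.1.1.1)).toNNReal q.2,
          ((t : ℝ) / q.1.1.1) ^ κ * Real.exp (-κ * ζ (Real.log (t / q.1.1.1)).toNNReal q.2)
            * q.1.1.2) B :=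
      (Measure.measurable_coe hB).comp ((hP.measurable_backwardKernel ht).comp
        (hζc.prodMk (((Measurable.pow_const (by fun_prop) κ).mul (hζc.const_mul (-κ)).exp).mul
          (by fun_prop))))
    convert hm.lintegral_prod_right' (ν := μ) using 2 with q
    have := lintegral_randomisedKernel (κ := κ) hP hζ q.2.1 q.2.2 q.1.2
      (measurable_one.indicator hB)
    simpa only [lintegral_indicator_one hB] using this

/-- The two-sided time change has the one-dimensional marginals of `Z`. -/
theorem identDistrib_timeChangeTwoSided_marginal (hκ : 0 < κ) (hZ : ∀ t, Measurable (Z t))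
    (hr : ∀ ω t, ContinuousWithinAt (fun t ↦ Z t ω) (Set.Ici t) t) (hs : IsSelfSimilar κ Z μ)
    (hζ : IsSubordinator ζ μ) (hind : IndepFun (fun ω t ↦ ζ t ω) (fun ω t ↦ Z t ω) μ) (t : ℝ≥0) :
    IdentDistrib (timeChangeTwoSided κ ζ Z t) (Z t) ((μ.prod μ).prod μ) μ := by
  rcases eq_or_ne t 0 with rfl | ht
  · have h1 : timeChangeTwoSided κ ζ Z 0 = fun _ ↦ 0 := funext (timeChangeTwoSided_zero hκ)
    have h2 : Z 0 =ᵐ[μ] fun _ ↦ 0 := hs.zero_ae_eq hκ hZ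
    refine ⟨h1 ▸ aemeasurable_const, (hZ 0).aemeasurable, ?_⟩
    rw [Measure.map_congr h2, h1]
    simp
  obtain ⟨a, ha⟩ := exists_exp_neg_le {t}
  have hat := ha t (Finset.mem_singleton_self t) (pos_iff_ne_zero.2 ht)
  have h1 := (sameFDD_timeChangeTwoSided hZ hr hs hζ hind a {t} (by simpa using hat)).comp
    (u := fun x ↦ x ⟨t, Finset.mem_singleton_self t⟩) (by fun_prop)
  exact h1.trans (identDistrib_timeChange_marginal hZ hr hs hζ hind hat)

/-- The process obtained by the two-sided time change is Markov with the randomised kernel. -/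
theorem isMarkovProcess_timeChangeTwoSided (hκ : 0 < κ) {hZ : ∀ t, StronglyMeasurable (Z t)}
    (hr : ∀ ω t, ContinuousWithinAt (fun t ↦ Z t ω) (Set.Ici t) t) (hss : IsSelfSimilar κ Z μ)
    (hZP : IsMarkovProcess Z hZ P μ) (hζ : IsSubordinator ζ μ)
    (hind : IndepFun (fun ω t ↦ ζ t ω) (fun ω t ↦ Z t ω) μ)
    (hX : ∀ t, StronglyMeasurable (timeChangeTwoSided κ ζ Z t)) :
    IsMarkovProcess (timeChangeTwoSided κ ζ Z) hX (randomisedKernel κ ζ μ P)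
      ((μ.prod μ).prod μ) := by
  have hfam := isMarkovFamily_randomisedKernel (κ := κ) hZP.family hζ
  have hZm : ∀ t, Measurable (Z t) := fun t ↦ (hZ t).measurable
  have hX0 : ∀ ω, timeChangeTwoSided κ ζ Z 0 ω = 0 := timeChangeTwoSided_zero hκ
  refine ⟨hfam, fun s t hst g hg ⟨K, hK⟩ ↦ ?_⟩
  rcases eq_or_ne s 0 with rfl | hs
  -- At `s = 0` the past is trivial: every cylinder is empty or everything, and only the marginal
  -- law at `t` matters.
  · have hprob : IsProbabilityMeasure (P 0 t 0) := hZP.family.prob 0 t 0 hst (Or.inr rfl)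
    have hlaw : ((μ.prod μ).prod μ).map (timeChangeTwoSided κ ζ Z t) = P 0 t 0 :=
      (identDistrib_timeChangeTwoSided_marginal hκ hZm hr hss hζ hind t).map_eq.trans
        (hZP.map_eq (hss.zero_ae_eq hκ hZm) t)
    have := condExp_eq_integral_of_cylinder (ν := (μ.prod μ).prod μ) hX (s := 0) (t := t)
      (Kernel.const ℝ (P 0 t 0)) (fun J C hC g hg ↦ ?_) hg hK
    · simpa only [Kernel.const_apply, randomisedKernel, if_true, hX0] using this
    · have hcyl : (fun ω (j : J) ↦ timeChangeTwoSided κ ζ Z j ω) = fun _ _ ↦ 0 := by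
        ext ω j
        rw [show ((j : Set.Iic (0 : ℝ≥0)) : ℝ≥0) = 0 from le_antisymm j.1.2 zero_le, hX0]
      simp only [hcyl, Kernel.const_apply, lintegral_const]
      by_cases h0 : (fun _ ↦ 0 : J → ℝ) ∈ C
      · simp only [Set.preimage_const_of_mem h0, Measure.restrict_univ, measure_univ, mul_one]
        rw [← hlaw, lintegral_map hg (hX t).measurable]
      · simp [Set.preimage_const_of_notMem h0]
  have hs : 0 < s := pos_iff_ne_zero.2 hs
  have ht : 0 < t := hs.trans_le hst
  let k : Kernel ℝ ℝ := ⟨randomisedKernel κ ζ μ P s t, hfam.measurable_right hs hst⟩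
  have : IsMarkovKernel k := ⟨fun x ↦ hfam.prob s t x hst (Or.inl hs)⟩
  refine condExp_eq_integral_of_cylinder hX k (fun J C hC g hg ↦ ?_) hg hK
  -- The identity on a cylinder involves only finitely many times, so it transfers to the product
  -- version of some `X^{(a)}`.
  obtain ⟨a, has, hat, K, hK0, hKs, C', hC', hCC', hid⟩ := exists_identDistrib_cylinder hX0
    (fun a ↦ (sameFDD_timeChangeTwoSided hZm hr hss hζ hind a).trans
      (sameFDD_timeChangeProd hZm hr hss hζ hind a)) hs ht J hC
  have hA : MeasurableSet ((fun ω (i : K) ↦ timeChangeTwoSided κ ζ Z i ω) ⁻¹' C') :=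
    hCC' ▸ measurableSet_cylinder hX J hC
  have hCm : Measurable (C'.indicator (1 : (K → ℝ) → ℝ≥0∞)) := measurable_one.indicator hC'
  rw [hCC', ← lintegral_indicator_one_mul hA, ← lintegral_indicator_one_mul hA]
  have e1 := (hid.comp (u := fun x : (K → ℝ) × ℝ × ℝ ↦ C'.indicator 1 x.1 * g x.2.2)
    ((hCm.comp measurable_fst).mul (hg.comp (by fun_prop)))).lintegral_eq
  have e2 := (hid.comp (u := fun x : (K → ℝ) × ℝ × ℝ ↦ C'.indicator 1 x.1 *
    ∫⁻ y, g y ∂(k x.2.1)) ((hCm.comp measurable_fst).mul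
      ((hg.lintegral_kernel).comp (by fun_prop)))).lintegral_eq
  exact e1.trans ((lintegral_timeChangeProd hr hss hZP hζ has hst hK0 hKs hC' hg).trans e2.symm)

end Markov


/-! ### The martingale property of the extended process -/

section Martingale

variable {Ω : Type*} [MeasurableSpace Ω] {μ : Measure Ω} [IsProbabilityMeasure μ] {κ : ℝ}
  {ζ Z : ℝ≥0 → Ω → ℝ}

theorem martingale_natural_of_cylinder {X : ℝ≥0 → Ω → ℝ} (hX : ∀ t, StronglyMeasurable (X t))
    (hint : ∀ t, Integrable (X t) μ)
    (h : ∀ s t, s ≤ t → ∀ (J : Finset (Set.Iic s)) (C : Set (J → ℝ)), MeasurableSet C →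
      ∫ ω in (fun ω (j : J) ↦ X j ω) ⁻¹' C, X t ω ∂μ
        = ∫ ω in (fun ω (j : J) ↦ X j ω) ⁻¹' C, X s ω ∂μ) :
    Martingale X (Filtration.natural X hX) μ := by
  refine ⟨Filtration.stronglyAdapted_natural hX, fun s t hst ↦ ?_⟩
  refine (ae_eq_condExp_of_forall_setIntegral_eq ((Filtration.natural X hX).le s) (hint t)
    (fun A _ _ ↦ (hint s).integrableOn) (fun A hA _ ↦ ?_)
    (Filtration.stronglyAdapted_natural hX s).aestronglyMeasurable).symm
  rw [← sub_eq_zero, ← integral_sub (hint s).integrableOn (hint t).integrableOn]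
  refine setIntegral_natural_eq_zero hX ((hint s).sub (hint t)) (fun J C hC ↦ ?_) hA
  simp only [Pi.sub_apply]
  rw [integral_sub (hint s).integrableOn (hint t).integrableOn, h s t hst J C hC, sub_self]

theorem integral_indicator_one_mul {Ω E : Type*} [MeasurableSpace Ω] {μ : Measure Ω} {V : Ω → E} {C : Set E}
    (hC : MeasurableSet (V ⁻¹' C)) (f : Ω → ℝ) :
    ∫ ω, C.indicator 1 (V ω) * f ω ∂μ = ∫ ω in V ⁻¹' C, f ω ∂μ := by
  rw [← integral_indicator hC]
  refine integral_congr_ae (ae_of_all _ fun ω ↦ ?_)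
  by_cases h : V ω ∈ C
  · simp [Set.indicator, h]
  · simp [Set.indicator, h]

/-- Integrability passes through the marginals, which are those of `Z`. For `s = 0` the claim is
that the mean vanishes, as it does for `Z`; for `s > 0` the cylinder identity comes from
`integral_timeChangeProd`. -/
theorem martingale_timeChangeTwoSided (hκ : 0 < κ) {hZ : ∀ t, StronglyMeasurable (Z t)}
    (hr : ∀ ω t, ContinuousWithinAt (fun t ↦ Z t ω) (Set.Ici t) t) (hss : IsSelfSimilar κ Z μ)
    (hZmart : Martingale Z (Filtration.natural Z hZ) μ) (hζ : IsSubordinator ζ μ)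
    (hind : IndepFun (fun ω t ↦ ζ t ω) (fun ω t ↦ Z t ω) μ)
    (hexp : ∀ s t : ℝ≥0, 0 < s → s ≤ t →
      ∫ ω, Real.exp (-κ * ζ (Real.log (t / s)).toNNReal ω) ∂μ = ((s : ℝ) / t) ^ κ)
    (hX : ∀ t, StronglyMeasurable (timeChangeTwoSided κ ζ Z t)) :
    Martingale (timeChangeTwoSided κ ζ Z) (Filtration.natural (timeChangeTwoSided κ ζ Z) hX)
      ((μ.prod μ).prod μ) := by
  have hZm : ∀ t, Measurable (Z t) := fun t ↦ (hZ t).measurable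
  have hX0 : ∀ ω, timeChangeTwoSided κ ζ Z 0 ω = 0 := timeChangeTwoSided_zero hκ
  have hmarg := identDistrib_timeChangeTwoSided_marginal hκ hZm hr hss hζ hind
  have hint : ∀ t, Integrable (timeChangeTwoSided κ ζ Z t) ((μ.prod μ).prod μ) := fun t ↦
    (hmarg t).integrable_iff.2 (hZmart.integrable t)
  refine martingale_natural_of_cylinder hX hint fun s t hst J C hC ↦ ?_
  rcases eq_or_ne s 0 with rfl | hs
  · have hcyl : (fun ω (j : J) ↦ timeChangeTwoSided κ ζ Z j ω) = fun _ _ ↦ 0 := by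
      ext ω j
      rw [show ((j : Set.Iic (0 : ℝ≥0)) : ℝ≥0) = 0 from le_antisymm j.1.2 zero_le, hX0]
    have hmean : ∫ ω, timeChangeTwoSided κ ζ Z t ω ∂((μ.prod μ).prod μ) = 0 := by
      have h1 := hZmart.setIntegral_eq hst MeasurableSet.univ
      rw [setIntegral_univ, setIntegral_univ, integral_congr_ae (hss.zero_ae_eq hκ hZm)] at h1
      rw [(hmarg t).integral_eq, ← h1, integral_zero]
    simp only [hcyl, hX0]
    by_cases h0 : (fun _ ↦ 0 : J → ℝ) ∈ C
    · simp [Set.preimage_const_of_mem h0, hmean]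
    · simp [Set.preimage_const_of_notMem h0]
  have hs : 0 < s := pos_iff_ne_zero.2 hs
  have ht : 0 < t := hs.trans_le hst
  obtain ⟨a, has, hat, K, hK0, hKs, C', hC', hCC', hid⟩ := exists_identDistrib_cylinder hX0
    (fun a ↦ (sameFDD_timeChangeTwoSided hZm hr hss hζ hind a).trans
      (sameFDD_timeChangeProd hZm hr hss hζ hind a)) hs ht J hC
  have hA : MeasurableSet ((fun ω (i : K) ↦ timeChangeTwoSided κ ζ Z i ω) ⁻¹' C') :=
    hCC' ▸ measurableSet_cylinder hX J hC
  have hCm : Measurable (C'.indicator (1 : (K → ℝ) → ℝ)) := measurable_one.indicator hC'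
  rw [hCC', ← integral_indicator_one_mul hA, ← integral_indicator_one_mul hA]
  have e1 := (hid.comp (u := fun x : (K → ℝ) × ℝ × ℝ ↦ C'.indicator 1 x.1 * x.2.2)
    ((hCm.comp measurable_fst).mul (by fun_prop))).integral_eq
  have e2 := (hid.comp (u := fun x : (K → ℝ) × ℝ × ℝ ↦ C'.indicator 1 x.1 * x.2.1)
    ((hCm.comp measurable_fst).mul (by fun_prop))).integral_eq
  have i1 := (hid.comp (u := fun x : (K → ℝ) × ℝ × ℝ ↦ x.2.1) (by fun_prop)).integrable_iff.1
    (hint s)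
  have i2 := (hid.comp (u := fun x : (K → ℝ) × ℝ × ℝ ↦ x.2.2) (by fun_prop)).integrable_iff.1
    (hint t)
  exact e1.trans ((integral_timeChangeProd hr hZmart hζ has hst (hexp s t hs hst) i1 i2 hK0 hKs
    hC').trans e2.symm)

end Martingale

/-! ### Doob's inequality and the limit at `0` -/

section CadlagAtZero

variable {Ω : Type*} [mΩ : MeasurableSpace Ω] {ν : Measure Ω} [IsProbabilityMeasure ν]
  {X : ℝ≥0 → Ω → ℝ} {ℱ : Filtration ℝ≥0 mΩ}

/-- Doob's maximal inequality along an arithmetic grid of `[0,δ]`. -/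
theorem martingale_maximal_grid (hX : Martingale X ℱ ν) (δ : ℝ≥0) (n : ℕ) (ε : ℝ≥0) :
    ε * ν {ω | ∃ k ≤ n + 1, (ε : ℝ) ≤ |X (δ * (k / (n + 1))) ω|}
      ≤ ENNReal.ofReal (∫ ω, |X δ ω| ∂ν) := by
  let τ : ℕ → ℝ≥0 := fun k ↦ δ * (k / (n + 1))
  have hτ : Monotone τ := fun i j hij ↦ by
    dsimp only [τ]
    gcongr
  let 𝒢 : Filtration ℕ mΩ := ⟨fun k ↦ ℱ (τ k), fun i j hij ↦ ℱ.mono (hτ hij), fun k ↦ ℱ.le _⟩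
  have hY : Martingale (fun k ↦ X (τ k)) 𝒢 ν :=
    ⟨fun k ↦ hX.1 _, fun i j hij ↦ hX.2 _ _ (hτ hij)⟩
  have hsub : Submartingale (fun k ω ↦ |X (τ k) ω|) 𝒢 ν :=
    hY.submartingale.sup hY.neg.submartingale
  have hend : τ (n + 1) = δ := by simp [τ]
  have h := maximal_ineq hsub (fun k ω ↦ abs_nonneg _) (ε := ε) (n + 1)
  have hset : {ω | ∃ k ≤ n + 1, (ε : ℝ) ≤ |X (δ * (k / (n + 1))) ω|}
      = {ω | (ε : ℝ) ≤ (Finset.range (n + 1 + 1)).sup' Finset.nonempty_range_add_one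
        fun k ↦ |X (τ k) ω|} := by
    ext ω
    simp [Finset.le_sup'_iff, τ]
  rw [hset]
  refine h.trans (ENNReal.ofReal_le_ofReal ?_)
  simp only [hend]
  exact setIntegral_le_integral (hX.integrable δ).abs (ae_of_all _ fun ω ↦ abs_nonneg _)

/-- Doob's maximal inequality on `(0,δ)` for martingales with right-continuous paths. -/
theorem martingale_maximal_Ioo (hX : Martingale X ℱ ν)
    (hr : ∀ ω t, 0 < t → ContinuousWithinAt (fun t ↦ X t ω) (Set.Ici t) t) {δ : ℝ≥0} (hδ : 0 < δ)
    (ε : ℝ≥0) :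
    ε * ν {ω | ∃ t, 0 < t ∧ t < δ ∧ (ε : ℝ) < |X t ω|} ≤ ENNReal.ofReal (∫ ω, |X δ ω| ∂ν) := by
  let S : ℕ → Set Ω := fun n ↦ {ω | ∃ k ≤ n + 1, (ε : ℝ) ≤ |X (δ * (k / (n + 1))) ω|}
  -- The grids are not nested, so the events `S n` need not increase. By right-continuity a large
  -- value of `|X|` is seen on all sufficiently fine grids, and the sets `T N` do increase.
  let T : ℕ → Set Ω := fun N ↦ ⋂ n ≥ N, S n
  have hT : Monotone T := fun N M hNM ↦
    Set.biInter_mono (fun n (hn : M ≤ n) ↦ hNM.trans hn) fun _ _ ↦ le_rfl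
  have hsub : {ω | ∃ t, 0 < t ∧ t < δ ∧ (ε : ℝ) < |X t ω|} ⊆ ⋃ N, T N := by
    rintro ω ⟨t, ht, htδ, hω⟩
    have h1 : Tendsto (fun n ↦ δ * approxRight n (t / δ)) atTop (𝓝[≥] t) := by
      have h2 := tendsto_nhdsWithin_iff.1 (tendsto_approxRight (t / δ))
      refine tendsto_nhdsWithin_iff.2 ⟨?_, ?_⟩
      · have := h2.1.const_mul δ
        rwa [mul_div_cancel₀ _ hδ.ne'] at this
      · filter_upwards [h2.2] with n hn
        have := mul_le_mul_right (Set.mem_Ici.1 hn) δ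
        rw [mul_div_cancel₀ _ hδ.ne'] at this
        exact this
    have h3 := ((hr ω t ht).tendsto.comp h1).abs.eventually (lt_mem_nhds hω)
    obtain ⟨N, hN⟩ := eventually_atTop.1 h3
    refine Set.mem_iUnion.2 ⟨N, Set.mem_iInter₂.2 fun n hn ↦ ⟨⌊((n : ℝ≥0) + 1) * (t / δ)⌋₊ + 1, ?_,
      ?_⟩⟩
    -- The strict inequality `t < δ` keeps the approximating grid point inside `[0, δ]`.
    · rw [add_le_add_iff_right]
      have h4 : ((n : ℝ≥0) + 1) * (t / δ) < ((n + 1 : ℕ) : ℝ≥0) := by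
        push_cast
        exact mul_lt_of_lt_one_right (by positivity) ((div_lt_one hδ).2 htδ)
      exact Nat.lt_succ_iff.1 ((Nat.floor_lt zero_le).2 h4)
    · have := (hN n hn).le
      simpa [approxRight, Function.comp_def] using this
  calc _ ≤ ε * ν (⋃ N, T N) := by gcongr
    _ = ⨆ N, ε * ν (T N) := by rw [hT.measure_iUnion, ENNReal.mul_iSup]
    _ ≤ _ := iSup_le fun N ↦ by
      refine le_trans ?_ (martingale_maximal_grid hX δ N ε)
      gcongr
      exact Set.biInter_subset_of_mem (Set.mem_Ici.2 le_rfl)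

/-- A right-continuous martingale on `(0,∞)` which tends to `0` in `L¹` at `0` has paths tending
to `0`. -/
theorem martingale_tendsto_zero (hX : Martingale X ℱ ν)
    (hr : ∀ ω t, 0 < t → ContinuousWithinAt (fun t ↦ X t ω) (Set.Ici t) t)
    (hlim : Tendsto (fun n : ℕ ↦ ∫ ω, |X (1 / (n + 1)) ω| ∂ν) atTop (𝓝 0)) :
    ∀ᵐ ω ∂ν, Tendsto (fun t ↦ X t ω) (𝓝[>] 0) (𝓝 0) := by
  have hpos : ∀ n : ℕ, (0 : ℝ≥0) < 1 / (n + 1) := fun n ↦ by positivity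
  have key : ∀ j : ℕ, ∀ᵐ ω ∂ν, ∃ n : ℕ, ∀ t : ℝ≥0, 0 < t → t < 1 / ((n : ℝ≥0) + 1) →
      |X t ω| ≤ ((1 / ((j : ℝ≥0) + 1) : ℝ≥0) : ℝ) := fun j ↦ by
    set ε : ℝ≥0 := 1 / ((j : ℝ≥0) + 1)
    have hε : (ε : ℝ≥0∞) ≠ 0 := ENNReal.coe_ne_zero.2 (hpos j).ne'
    -- A path that exceeds `ε` arbitrarily close to `0` exceeds it on every `(0, 1/(n+1))`, so each
    -- maximal inequality bounds the exceptional set.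
    have h1 : ∀ n : ℕ, ε * ν {ω | ¬ ∃ n : ℕ, ∀ t : ℝ≥0, 0 < t → t < 1 / ((n : ℝ≥0) + 1) →
        |X t ω| ≤ ε} ≤ ENNReal.ofReal (∫ ω, |X (1 / (n + 1)) ω| ∂ν) := fun n ↦ by
      refine le_trans ?_ (martingale_maximal_Ioo hX hr (hpos n) ε)
      gcongr with ω
      intro hω
      push Not at hω
      exact hω n
    have h2 := ENNReal.tendsto_ofReal hlim
    rw [ENNReal.ofReal_zero] at h2
    have h3 := le_antisymm (ge_of_tendsto' h2 h1) zero_le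
    exact (mul_eq_zero.1 h3).resolve_left hε
  filter_upwards [ae_all_iff.2 key] with ω hω
  rw [Metric.tendsto_nhds]
  intro ε hε
  obtain ⟨j, hj⟩ := exists_nat_one_div_lt hε
  obtain ⟨n, hn⟩ := hω j
  filter_upwards [Ioo_mem_nhdsGT (hpos n)] with t ht
  rw [dist_zero_right, Real.norm_eq_abs]
  refine (hn t ht.1 ht.2).trans_lt ?_
  simpa using hj

end CadlagAtZero

/-! ### Regularity at `0` for self-similar martingales -/

section CadlagTimeChange

variable {Ω : Type*} [MeasurableSpace Ω] {ν : Measure Ω} [IsProbabilityMeasure ν] {κ : ℝ}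
  {X : ℝ≥0 → Ω → ℝ}

/-- A self-similar martingale with càdlàg paths on `(0,∞)` has càdlàg paths on `[0,∞)`. -/
theorem IsSelfSimilar.ae_isCadlagAt (hκ : 0 < κ) (hXm : ∀ t, Measurable (X t))
    (hs : IsSelfSimilar κ X ν) {ℱ : Filtration ℝ≥0 ‹_›} (hX : Martingale X ℱ ν)
    (h0 : ∀ ω, X 0 ω = 0) (hc : ∀ ω t, 0 < t → IsCadlagAt (fun t ↦ X t ω) t) :
    ∀ᵐ ω ∂ν, ∀ t, IsCadlagAt (fun t ↦ X t ω) t := by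
  have hlim : Tendsto (fun n : ℕ ↦ ∫ ω, |X (1 / (n + 1)) ω| ∂ν) atTop (𝓝 0) := by
    have h1 : ∀ n : ℕ, ∫ ω, |X (1 / (n + 1)) ω| ∂ν
        = (1 / ((n : ℝ) + 1)) ^ κ * ∫ ω, |X 1 ω| ∂ν := fun n ↦ by
      have := ((hs.identDistrib hXm (c := 1 / ((n : ℝ≥0) + 1)) (by positivity)).comp
        (u := fun z ↦ |z 1|) (by fun_prop)).integral_eq
      simp only [Function.comp_def, mul_one, abs_mul, integral_const_mul] at this
      rw [this, abs_of_nonneg (by positivity)]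
      simp
    simp_rw [h1]
    have := ((tendsto_one_div_add_atTop_nhds_zero_nat (𝕜 := ℝ)).rpow_const (Or.inr hκ.le)
      (p := κ)).mul_const (∫ ω, |X 1 ω| ∂ν)
    rwa [Real.zero_rpow hκ.ne', zero_mul] at this
  filter_upwards [martingale_tendsto_zero hX (fun ω t ht ↦ (hc ω t ht).1) hlim] with ω hω t
  rcases eq_or_ne t 0 with rfl | ht
  · refine ⟨?_, 0, ?_⟩
    · rw [← Set.Ioi_insert, continuousWithinAt_insert_self, ContinuousWithinAt, h0]
      exact hω
    · simp
  · exact hc ω t (pos_iff_ne_zero.2 ht)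

end CadlagTimeChange


/-! ### Pointwise Chapman–Kolmogorov equations and scaling -/

section Transition

variable {Ω : Type*} [MeasurableSpace Ω] {μ : Measure Ω} [IsProbabilityMeasure μ] {κ : ℝ}
  {ζ : ℝ≥0 → Ω → ℝ} {P : ℝ≥0 → ℝ≥0 → ℝ → Measure ℝ}

/-- The Chapman–Kolmogorov equation for `P` combined with its scaling property. -/
theorem IsTransitionFunction.lintegral_backwardKernel (hP : IsTransitionFunction P)
    (hPs : HasScaling κ P) {u t v : ℝ≥0} (hut : u ≤ t) (ht : 0 < t) (htv : t ≤ v) {r x : ℝ}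
    (hr : 0 ≤ r) (hx : IsState u x) {B : Set ℝ} (hB : MeasurableSet B) :
    ∫⁻ y, backwardKernel P v (r, ((v : ℝ) / t) ^ κ * Real.exp (-κ * r) * y) B ∂(P u t x)
      = P ((Real.exp (-r)).toNNReal * (v / t) * u) v
        (((v : ℝ) / t) ^ κ * Real.exp (-κ * r) * x) B := by
  have hv : 0 < v := ht.trans_le htv
  -- Scaling by `c` moves `t` to `exp(-r) v`, the initial time of the backward kernel, so that the
  -- two transitions can be composed.
  set c : ℝ≥0 := (Real.exp (-r)).toNNReal * (v / t) with hc
  have hc0 : 0 < c := mul_pos (Real.toNNReal_pos.2 (Real.exp_pos _)) (div_pos hv ht)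
  have hcκ : (c : ℝ) ^ κ = ((v : ℝ) / t) ^ κ * Real.exp (-κ * r) := by
    rw [hc, NNReal.coe_mul, Real.coe_toNNReal _ (Real.exp_pos _).le, NNReal.coe_div,
      Real.mul_rpow (Real.exp_pos _).le (by positivity), ← Real.exp_mul]
    ring_nf
  have hct : c * t = (Real.exp (-|r|)).toNNReal * v := by
    rw [hc, mul_assoc, div_mul_cancel₀ _ ht.ne', abs_of_nonneg hr]
  have hct0 : 0 < c * t := mul_pos hc0 ht
  have hctv : c * t ≤ v := hct ▸ exp_neg_abs_mul_le v r
  have hcx : IsState (c * u) ((c : ℝ) ^ κ * x) :=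
    hx.imp (fun h ↦ mul_pos hc0 h) fun h ↦ by rw [h, mul_zero]
  simp only [backwardKernel, ← hct, ← hcκ]
  rw [← hP.chapman_kolmogorov (c * u) (c * t) v _ (mul_le_mul_right hut c) hctv hcx B hB,
    hPs c u t x hc0 hut hx]
  exact (lintegral_map ((Measure.measurable_coe hB).comp
    (hP.family.measurable_right hct0 hctv)) (by fun_prop)).symm

theorem randomisedKernel_apply {Ω : Type*} [MeasurableSpace Ω] {μ : Measure Ω} {κ : ℝ}
    {ζ : ℝ≥0 → Ω → ℝ} (hP : IsMarkovFamily P) (hζ : IsSubordinator ζ μ) {s t : ℝ≥0}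
    (hs : 0 < s) (hst : s ≤ t) (x : ℝ) {B : Set ℝ} (hB : MeasurableSet B) :
    randomisedKernel κ ζ μ P s t x B = ∫⁻ ω, backwardKernel P t
      (ζ (Real.log (t / s)).toNNReal ω,
        ((t : ℝ) / s) ^ κ * Real.exp (-κ * ζ (Real.log (t / s)).toNNReal ω) * x) B ∂μ := by
  simpa only [lintegral_indicator_one hB] using
    lintegral_randomisedKernel hP hζ hs hst x (measurable_one.indicator hB)

theorem randomisedKernel_self (hP : IsTransitionFunction P) (hζ : IsSubordinator ζ μ) {s : ℝ≥0}
    {x : ℝ} (hx : IsState s x) : randomisedKernel κ ζ μ P s s x = Measure.dirac x := by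
  rcases eq_or_ne s 0 with rfl | hs
  · rw [randomisedKernel, if_pos rfl, hP.self 0 x hx]
  · have hs' : (s : ℝ) ≠ 0 := NNReal.coe_ne_zero.2 hs
    rw [randomisedKernel, if_neg hs]
    simp only [div_self hs', Real.log_one, Real.toNNReal_zero, hζ.zero, neg_zero, Real.exp_zero,
      Real.toNNReal_one, one_mul, mul_zero, Real.one_rpow, hP.self s x hx]
    rw [Measure.bind_const, measure_univ, one_smul]

/-- Integrals of the randomised kernel against a transition probability of `P`. -/
theorem lintegral_randomisedKernel_transition (hP : IsTransitionFunction P) (hPs : HasScaling κ P)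
    (hζ : IsSubordinator ζ μ) {u t v : ℝ≥0} (hut : u ≤ t) (ht : 0 < t) (htv : t ≤ v) {x : ℝ}
    (hx : IsState u x) {B : Set ℝ} (hB : MeasurableSet B) :
    ∫⁻ y, randomisedKernel κ ζ μ P t v y B ∂(P u t x)
      = ∫⁻ ω, P ((Real.exp (-ζ (Real.log (v / t)).toNNReal ω)).toNNReal * (v / t) * u) v
        (((v : ℝ) / t) ^ κ * Real.exp (-κ * ζ (Real.log (v / t)).toNNReal ω) * x) B ∂μ := by
  have hprob := hP.family.prob u t x hut hx
  have hm := hζ.measurable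
  simp only [randomisedKernel_apply hP.family hζ ht htv _ hB]
  rw [lintegral_lintegral_swap]
  · exact lintegral_congr fun ω ↦
      hP.lintegral_backwardKernel hPs hut ht htv (hζ.nonneg _ _) hx hB
  · exact ((Measure.measurable_coe hB).comp ((hP.family.measurable_backwardKernel
      (ht.trans_le htv)).comp (by fun_prop))).aemeasurable

/-- Freezing both random times, scaling aligns the two transitions of `P` and Chapman–Kolmogorov
merges them into one depending only on the sum of two independent copies of `ζ p` and `ζ q`, which
has the law of `ζ (p + q)`. -/
theorem randomisedKernel_chapman_kolmogorov (hP : IsTransitionFunction P) (hPs : HasScaling κ P)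
    (hζ : IsSubordinator ζ μ) {s t v : ℝ≥0} {x : ℝ} (hst : s ≤ t) (htv : t ≤ v)
    (hx : IsState s x) {B : Set ℝ} (hB : MeasurableSet B) :
    ∫⁻ y, randomisedKernel κ ζ μ P t v y B ∂(randomisedKernel κ ζ μ P s t x)
      = randomisedKernel κ ζ μ P s v x B := by
  have hm := hζ.measurable
  rcases eq_or_ne s 0 with rfl | hs
  · obtain rfl : x = 0 := hx.resolve_left (lt_irrefl _)
    rw [show randomisedKernel κ ζ μ P 0 t 0 = P 0 t 0 from if_pos rfl,
      show randomisedKernel κ ζ μ P 0 v 0 = P 0 v 0 from if_pos rfl]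
    rcases eq_or_ne t 0 with rfl | ht
    · rw [hP.self 0 0 hx, lintegral_dirac,
        show randomisedKernel κ ζ μ P 0 v 0 = P 0 v 0 from if_pos rfl]
    -- From the state `0` at time `0` the random factors multiply zeros, so the average is over a
    -- constant.
    · rw [lintegral_randomisedKernel_transition hP hPs hζ hst (pos_iff_ne_zero.2 ht) htv hx hB]
      simp
  have hs : 0 < s := pos_iff_ne_zero.2 hs
  have ht : 0 < t := hs.trans_le hst
  have hv : 0 < v := ht.trans_le htv
  have hs' : (0 : ℝ) < s := NNReal.coe_pos.2 hs
  have ht' : (0 : ℝ) < t := NNReal.coe_pos.2 ht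
  have hv' : (0 : ℝ) < v := NNReal.coe_pos.2 hv
  set p : ℝ≥0 := (Real.log (t / s)).toNNReal with hp
  set q : ℝ≥0 := (Real.log (v / t)).toNNReal with hq
  have hpq : (Real.log (v / s)).toNNReal = p + q := by
    rw [hp, hq, ← Real.toNNReal_add (Real.log_nonneg ((one_le_div hs').2 (NNReal.coe_le_coe.2 hst)))
      (Real.log_nonneg ((one_le_div ht').2 (NNReal.coe_le_coe.2 htv))),
      Real.log_div ht'.ne' hs'.ne', Real.log_div hv'.ne' ht'.ne', Real.log_div hv'.ne' hs'.ne']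
    ring_nf
  let H : ℝ → ℝ≥0∞ := fun r ↦
    backwardKernel P v (r, ((v : ℝ) / s) ^ κ * Real.exp (-κ * r) * x) B
  have hH : Measurable H := (Measure.measurable_coe hB).comp
    ((hP.family.measurable_backwardKernel hv).comp (by fun_prop))
  have hrhs : randomisedKernel κ ζ μ P s v x B = ∫⁻ ω, (H ∘ ζ (p + q)) ω ∂μ := by
    rw [randomisedKernel_apply hP.family hζ hs (hst.trans htv) x hB, hpq]
    rfl
  have hadd := ((hζ.identDistrib_add p q).comp hH).lintegral_eq
  have hQ : Measurable fun y ↦ randomisedKernel κ ζ μ P t v y B := (Measure.measurable_coe hB).comp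
    ((isMarkovFamily_randomisedKernel hP.family hζ).measurable_right ht htv)
  rw [hrhs, ← hadd, lintegral_randomisedKernel hP.family hζ hs hst x hQ, lintegral_prod]
  · refine lintegral_congr fun ω ↦ ?_
    have hr := hζ.nonneg p ω
    rw [← hp, backwardKernel, lintegral_randomisedKernel_transition hP hPs hζ
      (exp_neg_abs_mul_le t _) ht htv (Or.inl (exp_neg_abs_mul_pos ht _)) hB]
    refine lintegral_congr fun ω' ↦ ?_
    have hr' := hζ.nonneg q ω'
    simp only [Function.comp, H, backwardKernel, ← hq]
    have e1 : (Real.exp (-ζ q ω')).toNNReal * (v / t) * ((Real.exp (-|ζ p ω|)).toNNReal * t)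
        = (Real.exp (-|ζ p ω + ζ q ω'|)).toNNReal * v := by
      rw [abs_of_nonneg hr, abs_of_nonneg (add_nonneg hr hr'), neg_add, exp_toNNReal_add]
      field_simp
    have e2 : ((v : ℝ) / t) ^ κ * Real.exp (-κ * ζ q ω')
          * (((t : ℝ) / s) ^ κ * Real.exp (-κ * ζ p ω) * x)
        = ((v : ℝ) / s) ^ κ * Real.exp (-κ * (ζ p ω + ζ q ω')) * x := by
      have : (v : ℝ) / s = v / t * (t / s) := by field_simp
      rw [this, Real.mul_rpow (by positivity) (by positivity), mul_add, Real.exp_add]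
      ring
    rw [e1, e2]
  · exact (hH.comp (by fun_prop)).aemeasurable

theorem isTransitionFunction_randomisedKernel (hP : IsTransitionFunction P) (hPs : HasScaling κ P)
    (hζ : IsSubordinator ζ μ) : IsTransitionFunction (randomisedKernel κ ζ μ P) where
  family := isMarkovFamily_randomisedKernel hP.family hζ
  self _ _ hx := randomisedKernel_self hP hζ hx
  chapman_kolmogorov _ _ _ _ hst htv hx _ hB :=
    randomisedKernel_chapman_kolmogorov hP hPs hζ hst htv hx hB

/-- The random variable in the kernel depends on `s` and `t` only through `t/s`, which scaling
preserves, so the scaling of `P` applies for each outcome. -/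
theorem hasScaling_randomisedKernel {Ω : Type*} [MeasurableSpace Ω] {μ : Measure Ω} {κ : ℝ}
    {ζ : ℝ≥0 → Ω → ℝ} (hP : IsMarkovFamily P) (hPs : HasScaling κ P)
    (hζ : IsSubordinator ζ μ) : HasScaling κ (randomisedKernel κ ζ μ P) := by
  intro c s t x hc hst hx
  rcases eq_or_ne s 0 with rfl | hs
  · have := hPs c 0 t x hc hst hx
    rw [mul_zero] at this
    rw [mul_zero, randomisedKernel, if_pos rfl, this, randomisedKernel, if_pos rfl]
  have hs : 0 < s := pos_iff_ne_zero.2 hs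
  have ht : 0 < t := hs.trans_le hst
  have hmap : Measurable fun y : ℝ ↦ (c : ℝ) ^ κ * y := by fun_prop
  have hdiv : ((c * t : ℝ≥0) : ℝ) / (c * s : ℝ≥0) = t / s := by
    rw [NNReal.coe_mul, NNReal.coe_mul, mul_div_mul_left _ _ (NNReal.coe_ne_zero.2 hc.ne')]
  ext B hB
  rw [Measure.map_apply hmap hB, randomisedKernel_apply hP hζ hs hst x (hmap hB),
    randomisedKernel_apply hP hζ (mul_pos hc hs) (mul_le_mul_right hst c) _ hB, hdiv]
  refine lintegral_congr fun ω ↦ ?_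
  rw [← Measure.map_apply hmap hB, backwardKernel, backwardKernel,
    ← hPs c _ t _ hc (exp_neg_abs_mul_le t _) (Or.inl (exp_neg_abs_mul_pos ht _))]
  congr 2
  · exact mul_left_comm _ _ _
  · ring

end Transition

end Mimicking
theorem mainTheorem2 {Ω : Type u} [MeasurableSpace Ω] (μ : Measure Ω) [IsProbabilityMeasure μ]
    (κ : ℝ) (hκ : 0 < κ)
    (Z : ℝ≥0 → Ω → ℝ) (hZ : ∀ t, StronglyMeasurable (Z t))
    (hZcadlag : ∀ ω t, Mimicking.IsCadlagAt (fun t ↦ Z t ω) t)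
    (hZself : Mimicking.IsSelfSimilar κ Z μ)
    (P : ℝ≥0 → ℝ≥0 → ℝ → Measure ℝ)
    (hZmarkov : Mimicking.IsMarkovProcess Z hZ P μ)
    (ζ : ℝ≥0 → Ω → ℝ) (hζ : Mimicking.IsSubordinator ζ μ)
    (hindep : IndepFun (fun ω t ↦ ζ t ω) (fun ω t ↦ Z t ω) μ) :
    -- each `X^{(a)}` has the marginals of `Z`
    (∀ (a : ℝ) (t : ℝ≥0), Real.exp (-a) ≤ t →
      IdentDistrib (Mimicking.timeChange κ ζ Z a t) (Z t) μ μ) ∧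
    -- consistency in `a`
    (∀ a b : ℝ, b ≤ a →
      Mimicking.SameFDD {t : ℝ≥0 | Real.exp (-b) ≤ t}
        (Mimicking.timeChange κ ζ Z a) μ (Mimicking.timeChange κ ζ Z b) μ) ∧
    -- the process on `[0,∞)`
    (∃ (Ω' : Type u) (_ : MeasurableSpace Ω') (ν : Measure Ω') (_ : IsProbabilityMeasure ν)
      (X : ℝ≥0 → Ω' → ℝ) (hX : ∀ t, StronglyMeasurable (X t)),
      (∀ ω, X 0 ω = 0) ∧
      (∀ ω, ∀ t, 0 < t → Mimicking.IsCadlagAt (fun t ↦ X t ω) t) ∧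
      (∀ a : ℝ, Mimicking.SameFDD {t : ℝ≥0 | Real.exp (-a) ≤ t}
        X ν (Mimicking.timeChange κ ζ Z a) μ) ∧
      Mimicking.IsSelfSimilar κ X ν ∧
      Mimicking.IsMarkovProcess X hX (Mimicking.randomisedKernel κ ζ μ P) ν ∧
      (Martingale Z (Filtration.natural Z hZ) μ →
        (∀ s t : ℝ≥0, 0 < s → s ≤ t →
          ∫ ω, Real.exp (-κ * ζ (Real.log (t / s)).toNNReal ω) ∂μ = ((s : ℝ) / t) ^ κ) →
        Martingale X (Filtration.natural X hX) ν ∧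
          ∀ᵐ ω ∂ν, ∀ t, Mimicking.IsCadlagAt (fun t ↦ X t ω) t)) ∧
    -- pointwise Chapman–Kolmogorov equations and scaling pass from `P` to the new kernel
    (Mimicking.IsTransitionFunction P → Mimicking.HasScaling κ P →
      Mimicking.IsTransitionFunction (Mimicking.randomisedKernel κ ζ μ P) ∧
        Mimicking.HasScaling κ (Mimicking.randomisedKernel κ ζ μ P)) := by
  have hZm : ∀ t, Measurable (Z t) := fun t ↦ (hZ t).measurable
  have hr : ∀ ω t, ContinuousWithinAt (fun t ↦ Z t ω) (Set.Ici t) t := fun ω t ↦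
    (hZcadlag ω t).1
  have hX : ∀ t, StronglyMeasurable (Mimicking.timeChangeTwoSided κ ζ Z t) := fun t ↦
    (Mimicking.measurable_timeChangeTwoSided hZm hr hζ t).stronglyMeasurable
  have hX0 : ∀ ω, Mimicking.timeChangeTwoSided κ ζ Z 0 ω = 0 :=
    Mimicking.timeChangeTwoSided_zero hκ
  have hcadlag : ∀ ω t, 0 < t →
      Mimicking.IsCadlagAt (fun t ↦ Mimicking.timeChangeTwoSided κ ζ Z t ω) t := fun ω t ht ↦
    Mimicking.isCadlagAt_timeChange κ (hZcadlag ω.2) (hζ.monotone_twoSided ω.1)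
      (hζ.continuousWithinAt_twoSided ω.1) ht
  have hself := Mimicking.isSelfSimilar_timeChangeTwoSided hκ hZm hr hZself hζ hindep
  refine ⟨fun a t ht ↦ Mimicking.identDistrib_timeChange_marginal hZm hr hZself hζ hindep ht,
    fun a b hba ↦ Mimicking.sameFDD_timeChange hZm hr hZself hζ hindep hba,
    ⟨(Ω × Ω) × Ω, inferInstance, (μ.prod μ).prod μ, inferInstance,
      Mimicking.timeChangeTwoSided κ ζ Z, hX, hX0, hcadlag,
      Mimicking.sameFDD_timeChangeTwoSided hZm hr hZself hζ hindep, hself,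
      Mimicking.isMarkovProcess_timeChangeTwoSided hκ hr hZself hZmarkov hζ hindep hX,
      fun hmart hexp ↦ ?_⟩,
    fun hP hPs ↦ ⟨Mimicking.isTransitionFunction_randomisedKernel hP hPs hζ,
      Mimicking.hasScaling_randomisedKernel hP.family hPs hζ⟩⟩
  have hXmart := Mimicking.martingale_timeChangeTwoSided hκ hr hZself hmart hζ hindep hexp hX
  exact ⟨hXmart, hself.ae_isCadlagAt hκ (fun t ↦ (hX t).measurable) hXmart hX0 hcadlag⟩
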